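/- Let $\beta>-\tfrac12$. There are constants $a(\beta),A(\beta)>0$, depending only on $\beta$, such that the following holds. Let $D\subset\mathbb C$ be a bounded convex domain (nonempty, open, convex, bounded) and let $\varphi\in\mathbb R$. Put $h(\varphi)=\max_{z\in\overline D}\operatorname{Re}(ze^{i\varphi})$ and $K(\lambda)=\int_D|e^{\lambda z}|^2\,dm(z)$, where $m$ is planar Lebesgue measure. Let $D_\varphi$ be the image of $D$ under $z\mapsto ze^{i\varphi}-h(\varphi)$ and, for $t<0$, let $s(t,\varphi)$ be the area of $D_\varphi\cap\{x+iy:\ t<x<0\}$. Let $F$ be an entire function of exponential type at most $\sigma$ such that $$I_\varphi=\int_0^\infty\frac{|F(re^{i\varphi})|^2}{K(re^{i\varphi})\,r^{2\beta}}\,dr<\infty .$$ Then the Borel transform of $F$, given by $\gamma(z)=\sum_{k\ge0}F^{(k)}(0)\,z^{-k-1}$ for $|z|>\sigma$, is given in the half-plane $\{\zeta:\operatorname{Re}(\zeta e^{i\varphi})>h(\varphi)\}$ by a function $\gamma$ analytic there (that is, one that equals the sum of the series at all points of the half-plane with $|z|>\sigma$), and for this $\gamma$ $$a(\beta)\,I_\varphi\le\int_{-\infty}^{\infty}\int_{-\infty}^{0}\frac{\bigl|\gamma''\bigl(e^{-i\varphi}(h(\varphi)-(x+iy))\bigr)\bigr|^2\,|x|^{2\beta+3}}{s(x,\varphi)}\,dx\,dy\le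 A(\beta)\,I_\varphi .$$ -/

import Mathlib

open MeasureTheory Set
open scoped ENNReal

/-- A bounded convex domain of the complex plane. -/
structure IsBoundedConvexDomain (D : Set ℂ) : Prop where
  isOpen : IsOpen D
  nonempty : D.Nonempty
  convex : Convex ℝ D
  isBounded : Bornology.IsBounded D

/-- The support function `h(φ) = max { Re (z e^{iφ}) : z ∈ closure D }`. -/
noncomputable def supportFn (D : Set ℂ) (φ : ℝ) : ℝ :=
  sSup ((fun z : ℂ => (z * Complex.exp (Complex.I * φ)).re) '' closure D)

/-- `K(z) = ∫_D |e^{zw}|² dm(w)`, with `m` the planar Lebesgue measure. -/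
noncomputable def bergmanK (D : Set ℂ) (z : ℂ) : ℝ :=
  ∫ w in D, ‖Complex.exp (z * w)‖ ^ 2

/-- The image `D_φ` of `D` under `z ↦ z e^{iφ} - h(φ)`. -/
noncomputable def rotatedDomain (D : Set ℂ) (φ : ℝ) : Set ℂ :=
  (fun z : ℂ => z * Complex.exp (Complex.I * φ) - (supportFn D φ : ℂ)) '' D

/-- The area `s(t, φ)` of the intersection of `D_φ` with the strip `t < Re w < 0`. -/
noncomputable def stripArea (D : Set ℂ) (t φ : ℝ) : ℝ :=
  (volume (rotatedDomain D φ ∩ {w : ℂ | t < w.re ∧ w.re < 0})).toReal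

/-- The open half-plane `P_φ = { ζ : Re (ζ e^{iφ}) > h(φ) }`. -/
def halfPlane (D : Set ℂ) (φ : ℝ) : Set ℂ :=
  {z : ℂ | supportFn D φ < (z * Complex.exp (Complex.I * φ)).re}

/-- `F` is an entire function of exponential type at most `σ`. -/
structure HasExpType (F : ℂ → ℂ) (σ : ℝ) : Prop where
  entire : Differentiable ℂ F
  bound : ∀ τ : ℝ, σ < τ → ∃ C : ℝ, ∀ z : ℂ, ‖F z‖ ≤ C * Real.exp (τ * ‖z‖)

/-- `γ` is, on the open set `U`, the (analytic continuation of the) Borel transform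
`∑ k, F^(k)(0) / z^(k+1)`, `|z| > σ`, of an entire function `F` of exponential type at most `σ`. -/
structure IsBorelTransformOn (F : ℂ → ℂ) (σ : ℝ) (U : Set ℂ) (γ : ℂ → ℂ) : Prop where
  analytic : DifferentiableOn ℂ γ U
  series : ∀ z ∈ U, σ < ‖z‖ →
    HasSum (fun k : ℕ => iteratedDeriv k F 0 / z ^ (k + 1)) (γ z)

/-- `I_φ = ∫_0^∞ |F(r e^{iφ})|² / (K(r e^{iφ}) r^{2β}) dr`, with values in `[0, ∞]`. -/
noncomputable def radialIntegral (D : Set ℂ) (β φ : ℝ) (F : ℂ → ℂ) : ℝ≥0∞ :=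
  ∫⁻ r in Ioi (0 : ℝ), ENNReal.ofReal
    (‖F (r * Complex.exp (Complex.I * φ))‖ ^ 2 /
      (bergmanK D (r * Complex.exp (Complex.I * φ)) * r ^ (2 * β)))

/-- `∫_{-∞}^∞ ∫_{-∞}^0 |γ''(e^{-iφ}(h(φ) - (x+iy)))|² |x|^{2β+3} / s(x, φ) dx dy`,
with values in `[0, ∞]`. -/
noncomputable def halfPlaneIntegral (D : Set ℂ) (β φ : ℝ) (γ : ℂ → ℂ) : ℝ≥0∞ :=
  ∫⁻ y : ℝ, ∫⁻ x in Iio (0 : ℝ), ENNReal.ofReal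
    (‖iteratedDeriv 2 γ (Complex.exp (-(Complex.I * φ)) *
        ((supportFn D φ : ℂ) - ((x : ℂ) + Complex.I * (y : ℂ))))‖ ^ 2 *
      |x| ^ (2 * β + 3) / stripArea D x φ)

/-!
Write `f(r) = F(r e^{iφ})`, `h = h(φ)`, `E = D_φ`, `w = ζ e^{iφ}`. Integrating the Taylor series of
`F` termwise shows that the Borel transform is the Laplace integral
`γ(ζ) = e^{iφ} ∫_0^∞ f(r) e^{-rw} dr` for large real `w`. Finiteness of the radial integral makes
this integral converge absolutely for `Re w > h` (`hasLaplaceMoments_of_rayDensity`; this is where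
`β > -1/2` enters), so by the identity theorem it continues `γ` to the half-plane
(`isBorelTransformOn_rayBorel`), uniquely (`IsBorelTransformOn.eqOn`).

On the line `Re w = h - x`, `x < 0`, the function `|γ''|` is the modulus of the Fourier transform of
`r² f(r) e^{-r(h-x)}`. Plancherel's theorem (`lintegral_enorm_halfLine_fourier_sq`) and Tonelli's
theorem therefore turn the half-plane integral into
`2π ∫_0^∞ |f(r)|² e^{-2rh} r⁴ J(r) dr` with `J(r) = ∫_{-∞}^0 e^{2rx} |x|^{2β+3} / s(x) dx`
(`lintegral_halfPlane_laplaceMoment`), while the radial integral is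
`∫_0^∞ |f(r)|² e^{-2rh} / (k(r) r^{2β}) dr` with `k(r) = ∫_E e^{2r Re w} dm(w)` (`bergmanK_ray`).

It remains to compare the weights, `r⁴ J(r) ≍ 1 / (k(r) r^{2β})` (`weight_comparison`). The area `s`
grows with the width of the strip, and convexity gives `s(ct) ≤ c² s(t)` for `c ≥ 1`: contract by
`1/c` towards a point of the closure of `E` on the imaginary axis (`volume_strip_mul_le`). Hence
`s(x)` may be replaced by `s(-1/r)` up to polynomial factors in `r|x|`, which the exponential absorbs;
so `k(r) ≍ s(-1/r)` and `J(r) ≍ r^{-2β-4} / s(-1/r)`, with constants depending on `β` only.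
-/

/-! ### Plancherel's theorem for integrable square-integrable functions -/

open FourierTransform in
/-- On `L¹ ∩ L²` the `L²` Fourier transform is the Fourier integral: both define the same tempered
distribution. -/
theorem fourier_toLp_ae_eq {f : ℝ → ℂ} (hf : Integrable f) (hf2 : MemLp f 2) :
    (𝓕 (hf2.toLp f) : Lp ℂ 2 (volume : Measure ℝ)) =ᵐ[volume] 𝓕 f := by
  have hcont : Continuous (𝓕 f) :=
    VectorFourier.fourierIntegral_continuous Real.continuous_fourierChar
      (by exact continuous_inner) hf
  have h1 : LocallyIntegrable (𝓕 (hf2.toLp f) : Lp ℂ 2 (volume : Measure ℝ)) volume :=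
    (Lp.memLp _).locallyIntegrable (by norm_num)
  refine ae_eq_of_integral_contDiff_smul_eq h1 hcont.locallyIntegrable fun g hg hgc => ?_
  have hgc' : HasCompactSupport (fun x => (g x : ℂ)) := hgc.comp_left (g := fun t : ℝ => (t : ℂ)) rfl
  have hgs : ContDiff ℝ (⊤ : ℕ∞) (fun x => (g x : ℂ)) := Complex.ofRealCLM.contDiff.comp hg
  let G : SchwartzMap ℝ ℂ := hgc'.toSchwartzMap hgs
  have hG : ∀ x, G x = (g x : ℂ) := fun x => rfl
  have key := congrArg (fun T => T G) (Lp.fourier_toTemperedDistribution_eq (hf2.toLp f))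
  simp only [TemperedDistribution.fourier_apply, Lp.toTemperedDistribution_apply] at key
  have h2 : ∫ x, (𝓕 G) x • (hf2.toLp f) x = ∫ x, (𝓕 G) x • f x := by
    refine integral_congr_ae ?_
    filter_upwards [hf2.coeFn_toLp] with x hx
    rw [hx]
  have h3 : ∫ x, (𝓕 G) x • f x = ∫ x, G x • 𝓕 f x := by
    have := VectorFourier.integral_fourierIntegral_smul_eq_flip (L := innerₗ ℝ)
      Real.continuous_fourierChar continuous_inner (G.integrable (μ := volume)) hf
    simpa [SchwartzMap.fourier_coe, flip_innerₗ] using! this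
  rw [h2, h3] at key
  simp only [hG] at key
  simpa using key.symm

open FourierTransform in
/-- Plancherel's theorem for the Fourier integral of a function in `L¹ ∩ L²`. -/
theorem lintegral_enorm_fourier_sq {f : ℝ → ℂ} (hf : Integrable f) (hf2 : MemLp f 2) :
    ∫⁻ v, ‖𝓕 f v‖ₑ ^ 2 = ∫⁻ x, ‖f x‖ₑ ^ 2 := by
  have h := Lp.norm_fourier_eq (hf2.toLp f)
  rw [Lp.norm_def, Lp.norm_def,
    ENNReal.toReal_eq_toReal_iff' (Lp.eLpNorm_ne_top _) (Lp.eLpNorm_ne_top _),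
    eLpNorm_congr_ae (fourier_toLp_ae_eq hf hf2), eLpNorm_congr_ae hf2.coeFn_toLp] at h
  have h' := congrArg (fun t : ℝ≥0∞ => t ^ (2 : ℕ)) h
  have key : ∀ g : ℝ → ℂ, eLpNorm g 2 volume ^ (2 : ℕ) = ∫⁻ x, ‖g x‖ₑ ^ 2 := by
    intro g
    have := eLpNorm_nnreal_pow_eq_lintegral (μ := (volume : Measure ℝ)) (f := g)
      (p := 2) (by norm_num)
    simpa only [NNReal.coe_ofNat, ENNReal.rpow_ofNat, ENNReal.coe_ofNat] using this
  simpa only [key] using h'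

/-- Plancherel's theorem for the one-sided Fourier integral with kernel `e^{iry}`. -/
theorem lintegral_enorm_halfLine_fourier_sq {u : ℝ → ℂ} (hu : IntegrableOn u (Ioi 0))
    (hu2 : MemLp u 2 (volume.restrict (Ioi 0))) :
    ∫⁻ y : ℝ, ‖∫ r in Ioi (0 : ℝ), u r * Complex.exp (Complex.I * r * y)‖ₑ ^ 2 =
      ENNReal.ofReal (2 * Real.pi) * ∫⁻ r in Ioi (0 : ℝ), ‖u r‖ₑ ^ 2 := by
  have hf : Integrable ((Ioi (0 : ℝ)).indicator u) :=
    (integrable_indicator_iff measurableSet_Ioi).2 hu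
  have hf2 : MemLp ((Ioi (0 : ℝ)).indicator u) 2 :=
    (memLp_indicator_iff_restrict measurableSet_Ioi).2 hu2
  have h := lintegral_enorm_fourier_sq hf hf2
  have h1 : ∫⁻ x, ‖(Ioi (0 : ℝ)).indicator u x‖ₑ ^ 2 = ∫⁻ r in Ioi (0 : ℝ), ‖u r‖ₑ ^ 2 := by
    rw [← lintegral_indicator measurableSet_Ioi]
    congr 1 with x
    by_cases hx : x ∈ Ioi (0 : ℝ) <;> simp [hx]
  have h2 : ∀ v : ℝ, FourierTransform.fourier ((Ioi (0 : ℝ)).indicator u) v =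
      ∫ r in Ioi (0 : ℝ), u r * Complex.exp (Complex.I * r * ((-(2 * Real.pi) * v : ℝ) : ℂ)) := by
    intro v
    rw [Real.fourier_real_eq_integral_exp_smul, ← integral_indicator measurableSet_Ioi]
    congr 1 with r
    by_cases hx : r ∈ Ioi (0 : ℝ)
    · simp only [indicator_of_mem hx, smul_eq_mul]
      rw [mul_comm]
      congr 2
      push_cast
      ring
    · simp [hx]
  have hpi : -(2 * Real.pi) ≠ 0 := by have := Real.pi_pos; nlinarith
  set Φ : ℝ → ℝ≥0∞ :=
    fun y => ‖∫ r in Ioi (0 : ℝ), u r * Complex.exp (Complex.I * r * y)‖ₑ ^ 2 with hΦ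
  have hmap := Real.map_volume_mul_left hpi
  have hsc : ∫⁻ v, Φ (-(2 * Real.pi) * v) =
      ENNReal.ofReal |(-(2 * Real.pi))⁻¹| * ∫⁻ y, Φ y := by
    rw [← smul_eq_mul (ENNReal.ofReal _) (∫⁻ y, Φ y), ← lintegral_smul_measure, ← hmap]
    exact ((Homeomorph.mulLeft₀ _ hpi).measurableEmbedding.lintegral_map _).symm
  rw [h1] at h
  simp only [h2] at h
  rw [← h]
  change _ = _ * ∫⁻ v, Φ (-(2 * Real.pi) * v)
  rw [hsc, ← mul_assoc, ← ENNReal.ofReal_mul (by positivity)]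
  have : 2 * Real.pi * |(-(2 * Real.pi))⁻¹| = 1 := by
    rw [abs_inv, abs_neg, abs_of_pos (by positivity)]
    field_simp
  rw [this]
  simp

/-! ### The rotated domain -/

/-- A bounded convex domain in the left half-plane whose closure touches the imaginary axis; the
normal form `D_φ` of a bounded convex domain `D` seen from the direction `φ`. -/
structure IsLeftDomain (E : Set ℂ) : Prop extends IsBoundedConvexDomain E where
  re_neg : ∀ z ∈ E, z.re < 0
  exists_re_eq_zero : ∃ p ∈ closure E, p.re = 0

/-- The homeomorphism `z ↦ z e^{iφ} - h(φ)` carrying `D` onto `D_φ`. -/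
noncomputable def rotateShift (D : Set ℂ) (φ : ℝ) : ℂ ≃ₜ ℂ :=
  (rotation (Circle.exp φ)).toHomeomorph.trans (Homeomorph.subRight (supportFn D φ : ℂ))

theorem rotateShift_apply (D : Set ℂ) (φ : ℝ) (z : ℂ) :
    rotateShift D φ z = z * Complex.exp (Complex.I * φ) - (supportFn D φ : ℂ) := by
  simp [rotateShift, Circle.coe_exp, mul_comm]

theorem measurePreserving_rotateShift (D : Set ℂ) (φ : ℝ) :
    MeasurePreserving (rotateShift D φ) :=
  (measurePreserving_sub_right volume (supportFn D φ : ℂ)).comp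
    (rotation (Circle.exp φ)).measurePreserving

theorem rotatedDomain_eq_image (D : Set ℂ) (φ : ℝ) :
    rotatedDomain D φ = rotateShift D φ '' D :=
  image_congr fun z _ => (rotateShift_apply D φ z).symm

theorem IsBoundedConvexDomain.isCompact_closure {D : Set ℂ} (hD : IsBoundedConvexDomain D) :
    IsCompact (closure D) :=
  Metric.isCompact_of_isClosed_isBounded isClosed_closure hD.isBounded.closure

theorem IsBoundedConvexDomain.isLeftDomain_rotatedDomain {D : Set ℂ}
    (hD : IsBoundedConvexDomain D) (φ : ℝ) : IsLeftDomain (rotatedDomain D φ) := by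
  have hcont : Continuous fun z : ℂ => (z * Complex.exp (Complex.I * φ)).re := by fun_prop
  have hcpt := hD.isCompact_closure.image hcont
  have hne := hD.nonempty.closure.image fun z : ℂ => (z * Complex.exp (Complex.I * φ)).re
  have hle : ∀ z ∈ closure D, (z * Complex.exp (Complex.I * φ)).re ≤ supportFn D φ :=
    fun z hz => le_csSup hcpt.bddAbove (mem_image_of_mem _ hz)
  have hexp : Complex.exp (-(Complex.I * φ)) * Complex.exp (Complex.I * φ) = 1 := by
    rw [← Complex.exp_add]; simp
  refine ⟨⟨?_, hD.nonempty.image _, ?_, ?_⟩, ?_, ?_⟩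
  · rw [rotatedDomain_eq_image]
    exact (rotateShift D φ).isOpenMap _ hD.isOpen
  · rintro _ ⟨z, hz, rfl⟩ _ ⟨w, hw, rfl⟩ a b ha hb hab
    refine ⟨a • z + b • w, hD.convex hz hw ha hb hab, ?_⟩
    have hab' : (a : ℂ) + b = 1 := by exact_mod_cast hab
    simp only [Complex.real_smul]
    linear_combination (supportFn D φ : ℂ) * hab'
  · have : IsCompact (rotateShift D φ '' closure D) :=
      hD.isCompact_closure.image (rotateShift D φ).continuous
    rw [rotatedDomain_eq_image]
    exact this.isBounded.subset (image_mono subset_closure)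
  · rintro _ ⟨z, hz, rfl⟩
    -- a point of the open set `D` can be moved a little in the direction `e^{-iφ}`
    have hc : Continuous fun ε : ℝ => z + ε * Complex.exp (-(Complex.I * φ)) := by fun_prop
    have hnear : ∀ᶠ ε : ℝ in nhds 0, z + ε * Complex.exp (-(Complex.I * φ)) ∈ D :=
      hc.continuousAt.eventually_mem (by simpa using hD.isOpen.mem_nhds hz)
    obtain ⟨δ, hδ, hball⟩ := Metric.eventually_nhds_iff.1 hnear
    have hmem := hball (y := δ / 2) (by simp [abs_of_pos hδ, hδ])
    have := hle _ (subset_closure hmem)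
    rw [add_mul, mul_assoc, hexp, mul_one, Complex.add_re, Complex.ofReal_re] at this
    rw [Complex.sub_re, Complex.ofReal_re]
    linarith
  · obtain ⟨z, hz, hzm⟩ := hcpt.sSup_mem hne
    refine ⟨rotateShift D φ z, ?_, ?_⟩
    · rw [rotatedDomain_eq_image, ← (rotateShift D φ).image_closure]
      exact mem_image_of_mem _ hz
    · rw [rotateShift_apply, Complex.sub_re, Complex.ofReal_re, sub_eq_zero]
      exact hzm

/-! ### Areas of strips -/

/-- The part of `E` in the strip `t < Re w < 0`. -/
def strip (E : Set ℂ) (t : ℝ) : Set ℂ := E ∩ {w : ℂ | t < w.re ∧ w.re < 0}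

theorem strip_anti (E : Set ℂ) {t t' : ℝ} (h : t ≤ t') : strip E t' ⊆ strip E t :=
  fun _ hw => ⟨hw.1, h.trans_lt hw.2.1, hw.2.2⟩

theorem measurableSet_strip {E : Set ℂ} (hE : IsLeftDomain E) (t : ℝ) :
    MeasurableSet (strip E t) :=
  hE.isOpen.measurableSet.inter
    ((isOpen_lt continuous_const Complex.continuous_re).inter
      (isOpen_lt Complex.continuous_re continuous_const)).measurableSet

theorem volume_strip_ne_top {E : Set ℂ} (hE : IsLeftDomain E) (t : ℝ) :
    volume (strip E t) ≠ ⊤ :=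
  (hE.isBounded.subset inter_subset_left).measure_lt_top.ne

theorem volume_strip_pos {E : Set ℂ} (hE : IsLeftDomain E) {t : ℝ} (ht : t < 0) :
    0 < volume (strip E t) := by
  have hopen : IsOpen (strip E t) := hE.isOpen.inter
    ((isOpen_lt continuous_const Complex.continuous_re).inter
      (isOpen_lt Complex.continuous_re continuous_const))
  obtain ⟨p, hp, hp0⟩ := hE.exists_re_eq_zero
  have hU : IsOpen {w : ℂ | t < w.re} := isOpen_lt continuous_const Complex.continuous_re
  obtain ⟨w, hw, hwE⟩ := mem_closure_iff.1 hp _ hU (by simpa [hp0] using ht)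
  exact hopen.measure_pos _ ⟨w, hwE, hw, hE.re_neg w hwE⟩

/-- A homothety of ratio `1/c` centred at a boundary point of `E` on the imaginary axis maps
the strip of width `c |t|` into the strip of width `|t|`. -/
theorem volume_strip_mul_le {E : Set ℂ} (hE : IsLeftDomain E) {c : ℝ} (hc : 1 ≤ c) (t : ℝ) :
    volume (strip E (c * t)) ≤ ENNReal.ofReal (c ^ 2) * volume (strip E t) := by
  obtain ⟨p, hp, hp0⟩ := hE.exists_re_eq_zero
  have hc0 : 0 < c := one_pos.trans_le hc
  have hsub : AffineMap.homothety p c⁻¹ '' strip E (c * t) ⊆ strip E t := by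
    rintro _ ⟨z, ⟨hzE, hz1, hz2⟩, rfl⟩
    have hre : (AffineMap.homothety p c⁻¹ z).re = c⁻¹ * z.re := by
      simp [AffineMap.homothety_apply, hp0]
    refine ⟨?_, ?_, ?_⟩
    · rcases hc.eq_or_lt with rfl | hc1
      · simpa using hzE
      · have := hE.convex.openSegment_closure_interior_subset_interior hp
          (by rwa [hE.isOpen.interior_eq] : z ∈ interior E)
        rw [hE.isOpen.interior_eq] at this
        refine this ⟨1 - c⁻¹, c⁻¹, by simpa using inv_lt_one_of_one_lt₀ hc1, by positivity,
          by ring, ?_⟩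
        simp [AffineMap.homothety_apply]
        ring
    · rw [hre]
      calc t = c⁻¹ * (c * t) := by field_simp
        _ < c⁻¹ * z.re := by gcongr
    · rw [hre]
      exact mul_neg_of_pos_of_neg (by positivity) hz2
  have h := measure_mono (μ := volume) hsub
  rw [Measure.addHaar_image_homothety, Complex.finrank_real_complex,
    abs_of_pos (by positivity)] at h
  calc volume (strip E (c * t))
      = ENNReal.ofReal (c ^ 2) * (ENNReal.ofReal (c⁻¹ ^ 2) * volume (strip E (c * t))) := by
        rw [← mul_assoc, ← ENNReal.ofReal_mul (by positivity)]
        have : c ^ 2 * c⁻¹ ^ 2 = 1 := by field_simp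
        rw [this]; simp
    _ ≤ _ := by gcongr

/-- The area of a strip of `E`, as a real number. -/
noncomputable def stripVol (E : Set ℂ) (t : ℝ) : ℝ := (volume (strip E t)).toReal

theorem stripVol_pos {E : Set ℂ} (hE : IsLeftDomain E) {t : ℝ} (ht : t < 0) :
    0 < stripVol E t :=
  ENNReal.toReal_pos (volume_strip_pos hE ht).ne' (volume_strip_ne_top hE t)

theorem stripVol_antitone {E : Set ℂ} (hE : IsLeftDomain E) : Antitone (stripVol E) :=
  fun _ _ h => ENNReal.toReal_mono (volume_strip_ne_top hE _) (measure_mono (strip_anti E h))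

theorem stripVol_mul_le {E : Set ℂ} (hE : IsLeftDomain E) {c : ℝ} (hc : 1 ≤ c) (t : ℝ) :
    stripVol E (c * t) ≤ c ^ 2 * stripVol E t := by
  have := ENNReal.toReal_mono (ENNReal.mul_ne_top ENNReal.ofReal_ne_top (volume_strip_ne_top hE t))
    (volume_strip_mul_le hE hc t)
  rwa [ENNReal.toReal_mul, ENNReal.toReal_ofReal (by positivity)] at this

/-! ### The exponential mass of the domain -/

/-- `k(r) = ∫_E e^{2 r Re w} dm(w)`, so that `K(r e^{iφ}) = e^{2 r h(φ)} k(r)` for `E = D_φ`. -/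
noncomputable def expMass (E : Set ℂ) (r : ℝ) : ℝ :=
  (∫⁻ w in E, ENNReal.ofReal (Real.exp (2 * r * w.re))).toReal

theorem bergmanK_ray {D : Set ℂ} (φ r : ℝ) :
    bergmanK D (r * Complex.exp (Complex.I * φ)) =
      Real.exp (2 * r * supportFn D φ) * expMass (rotatedDomain D φ) r := by
  have hnorm : ∀ w : ℂ, ‖Complex.exp (r * Complex.exp (Complex.I * φ) * w)‖ ^ 2 =
      Real.exp (2 * r * supportFn D φ) * Real.exp (2 * r * (rotateShift D φ w).re) := by
    intro w
    rw [Complex.norm_exp, ← Real.exp_nat_mul, ← Real.exp_add, rotateShift_apply, mul_assoc,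
      Complex.re_ofReal_mul, mul_comm (Complex.exp _) w]
    congr 1
    simp only [Complex.sub_re, Complex.ofReal_re]
    push_cast
    ring
  have hmp := measurePreserving_rotateShift D φ
  have hemb := (rotateShift D φ).measurableEmbedding
  rw [bergmanK, expMass, rotatedDomain_eq_image,
    ← hmp.setLIntegral_comp_emb hemb]
  simp only [hnorm]
  rw [integral_const_mul]
  congr 1
  rw [integral_eq_lintegral_of_nonneg_ae]
  · exact Filter.Eventually.of_forall fun w => (Real.exp_pos _).le
  · have : Continuous fun w : ℂ => Real.exp (2 * r * (rotateShift D φ w).re) :=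
      Real.continuous_exp.comp (continuous_const.mul
        (Complex.continuous_re.comp (rotateShift D φ).continuous))
    exact this.aestronglyMeasurable

/-- The absolute constant in the upper bound of `expMass`. -/
noncomputable def massConst : ℝ := ∑' n : ℕ, Real.exp (-2) ^ n * ((n : ℝ) + 1) ^ 2

theorem summable_massConst : Summable fun n : ℕ => Real.exp (-2) ^ n * ((n : ℝ) + 1) ^ 2 := by
  have hr : ‖Real.exp (-2)‖ < 1 := by
    rw [Real.norm_of_nonneg (Real.exp_pos _).le]
    simp
  have h0 := summable_pow_mul_geometric_of_norm_lt_one 0 hr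
  have h1 := summable_pow_mul_geometric_of_norm_lt_one 1 hr
  have h2 := summable_pow_mul_geometric_of_norm_lt_one 2 hr
  refine ((h2.add (h1.mul_left 2)).add h0).congr fun n => ?_
  ring

theorem massConst_pos : 0 < massConst :=
  summable_massConst.tsum_pos (fun n => by positivity) 0 (by simp)

theorem lintegral_exp_le {E : Set ℂ} (hE : IsLeftDomain E) {r : ℝ} (hr : 0 < r) :
    ∫⁻ w in E, ENNReal.ofReal (Real.exp (2 * r * w.re)) ≤
      ENNReal.ofReal (massConst * stripVol E (-(1 / r))) := by
  -- cut `E` into strips of width `1 / r`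
  let A : ℕ → Set ℂ := fun n => strip E (-((n + 1 : ℝ) / r)) ∩ {w | w.re ≤ -(n / r)}
  have hcover : E ⊆ ⋃ n, A n := by
    intro w hw
    have hneg := hE.re_neg w hw
    have hx : 0 ≤ -w.re * r := by nlinarith
    refine mem_iUnion.2 ⟨⌊-w.re * r⌋₊, ⟨hw, ?_, hneg⟩, ?_⟩
    · have := Nat.lt_floor_add_one (-w.re * r)
      rw [neg_lt, lt_div_iff₀ hr]
      exact this
    · have := Nat.floor_le hx
      rw [mem_ofPred_eq, le_neg, div_le_iff₀ hr]
      exact this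
  have hterm : ∀ n : ℕ, ∫⁻ w in A n, ENNReal.ofReal (Real.exp (2 * r * w.re)) ≤
      ENNReal.ofReal (Real.exp (-2) ^ n * ((n : ℝ) + 1) ^ 2 * stripVol E (-(1 / r))) := by
    intro n
    have hmeas : MeasurableSet (A n) := (measurableSet_strip hE _).inter
      (isClosed_le Complex.continuous_re continuous_const).measurableSet
    have h1 : ∀ w ∈ A n, ENNReal.ofReal (Real.exp (2 * r * w.re)) ≤
        ENNReal.ofReal (Real.exp (-2) ^ n) := by
      intro w hw
      have hw2 : w.re ≤ -(n / r) := hw.2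
      rw [← Real.exp_nat_mul]
      refine ENNReal.ofReal_le_ofReal (Real.exp_le_exp.2 ?_)
      calc 2 * r * w.re ≤ 2 * r * (-(n / r)) := by gcongr
        _ = n * -2 := by field_simp
    have h2 : volume (A n) ≤ ENNReal.ofReal (((n : ℝ) + 1) ^ 2 * stripVol E (-(1 / r))) := by
      calc volume (A n) ≤ volume (strip E (((n : ℝ) + 1) * (-(1 / r)))) := by
            refine measure_mono (inter_subset_left.trans (le_of_eq ?_))
            congr 1
            ring
        _ ≤ ENNReal.ofReal (((n : ℝ) + 1) ^ 2) * volume (strip E (-(1 / r))) :=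
            volume_strip_mul_le hE (by simp) _
        _ = _ := by
            rw [ENNReal.ofReal_mul (by positivity), stripVol,
              ENNReal.ofReal_toReal (volume_strip_ne_top hE _)]
    calc ∫⁻ w in A n, ENNReal.ofReal (Real.exp (2 * r * w.re))
        ≤ ∫⁻ _ in A n, ENNReal.ofReal (Real.exp (-2) ^ n) := setLIntegral_mono' hmeas h1
      _ = ENNReal.ofReal (Real.exp (-2) ^ n) * volume (A n) := setLIntegral_const _ _
      _ ≤ ENNReal.ofReal (Real.exp (-2) ^ n) *
            ENNReal.ofReal (((n : ℝ) + 1) ^ 2 * stripVol E (-(1 / r))) := by gcongr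
      _ = _ := by rw [← ENNReal.ofReal_mul (by positivity), mul_assoc]
  calc ∫⁻ w in E, ENNReal.ofReal (Real.exp (2 * r * w.re))
      ≤ ∫⁻ w in ⋃ n, A n, ENNReal.ofReal (Real.exp (2 * r * w.re)) := lintegral_mono_set hcover
    _ ≤ ∑' n, ∫⁻ w in A n, ENNReal.ofReal (Real.exp (2 * r * w.re)) := lintegral_iUnion_le _ _
    _ ≤ ∑' n : ℕ,
          ENNReal.ofReal (Real.exp (-2) ^ n * ((n : ℝ) + 1) ^ 2 * stripVol E (-(1 / r))) :=
        ENNReal.tsum_le_tsum hterm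
    _ = _ := by
        rw [massConst, ← tsum_mul_right, ENNReal.ofReal_tsum_of_nonneg]
        · exact fun n => mul_nonneg (by positivity) ENNReal.toReal_nonneg
        · exact summable_massConst.mul_right _

theorem expMass_le {E : Set ℂ} (hE : IsLeftDomain E) {r : ℝ} (hr : 0 < r) :
    expMass E r ≤ massConst * stripVol E (-(1 / r)) :=
  ENNReal.toReal_le_of_le_ofReal (mul_nonneg massConst_pos.le ENNReal.toReal_nonneg)
    (lintegral_exp_le hE hr)

theorem le_expMass {E : Set ℂ} (hE : IsLeftDomain E) {r : ℝ} (hr : 0 < r) :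
    Real.exp (-2) * stripVol E (-(1 / r)) ≤ expMass E r := by
  refine (ENNReal.ofReal_le_iff_le_toReal
    ((lintegral_exp_le hE hr).trans_lt ENNReal.ofReal_lt_top).ne).1 ?_
  rw [ENNReal.ofReal_mul (by positivity), stripVol,
    ENNReal.ofReal_toReal (volume_strip_ne_top hE _)]
  calc ENNReal.ofReal (Real.exp (-2)) * volume (strip E (-(1 / r)))
      = ∫⁻ _ in strip E (-(1 / r)), ENNReal.ofReal (Real.exp (-2)) := (setLIntegral_const _ _).symm
    _ ≤ ∫⁻ w in strip E (-(1 / r)), ENNReal.ofReal (Real.exp (2 * r * w.re)) := by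
        refine setLIntegral_mono' (measurableSet_strip hE _) fun w hw => ?_
        refine ENNReal.ofReal_le_ofReal (Real.exp_le_exp.2 ?_)
        calc (-2 : ℝ) = 2 * r * (-(1 / r)) := by field_simp
          _ ≤ 2 * r * w.re := by have := hw.2.1.le; gcongr
    _ ≤ _ := lintegral_mono_set inter_subset_left

theorem expMass_pos {E : Set ℂ} (hE : IsLeftDomain E) {r : ℝ} (hr : 0 < r) :
    0 < expMass E r :=
  (mul_pos (Real.exp_pos _) (stripVol_pos hE (by simpa using hr))).trans_le (le_expMass hE hr)

theorem expMass_le_volume {E : Set ℂ} (hE : IsLeftDomain E) {r : ℝ} (hr : 0 < r) :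
    expMass E r ≤ (volume E).toReal := by
  refine ENNReal.toReal_mono hE.isBounded.measure_lt_top.ne ?_
  calc ∫⁻ w in E, ENNReal.ofReal (Real.exp (2 * r * w.re)) ≤ ∫⁻ _ in E, 1 := by
        refine setLIntegral_mono' hE.isOpen.measurableSet fun w hw => ?_
        rw [← ENNReal.ofReal_one]
        refine ENNReal.ofReal_le_ofReal (Real.exp_le_one_iff.2 ?_)
        have := hE.re_neg w hw
        have : 0 < r * -w.re := mul_pos hr (by linarith)
        linarith
    _ = volume E := by simp

theorem measurable_expMass {E : Set ℂ} : Measurable (expMass E) := by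
  have hc : Continuous fun p : ℝ × ℂ => Real.exp (2 * p.1 * p.2.re) := by fun_prop
  have : Measurable fun r : ℝ => ∫⁻ w in E, ENNReal.ofReal (Real.exp (2 * r * w.re)) :=
    hc.measurable.ennreal_ofReal.lintegral_prod_right'
      (f := fun p : ℝ × ℂ => ENNReal.ofReal (Real.exp (2 * p.1 * p.2.re)))
  exact this.ennreal_toReal

/-! ### The weight of the half-plane integral -/

/-- `J(r) = ∫_{-∞}^0 e^{2rx} |x|^{2β+3} / s(x) dx`, the weight which the half-plane integral puts
on the frequency `r`. -/
noncomputable def stripWeight (E : Set ℂ) (β r : ℝ) : ℝ≥0∞ :=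
  ∫⁻ x in Iio (0 : ℝ), ENNReal.ofReal (Real.exp (2 * r * x) * |x| ^ (2 * β + 3) / stripVol E x)

/-- The lower bound for `stripWeight` comes from the interval `(-1/r, -1/(2r))` alone. -/
theorem le_stripWeight {E : Set ℂ} (hE : IsLeftDomain E) {β r : ℝ} (hβ : -(1 / 2 : ℝ) < β)
    (hr : 0 < r) :
    ENNReal.ofReal (Real.exp (-2) * (1 / (2 * r)) ^ (2 * β + 4) / stripVol E (-(1 / r))) ≤
      stripWeight E β r := by
  have hs := stripVol_pos hE (t := -(1 / r)) (by simpa using hr)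
  have hlen : -(1 / (2 * r)) - -(1 / r) = 1 / (2 * r) := by field_simp; ring
  have hsub : Ioo (-(1 / r)) (-(1 / (2 * r))) ⊆ Iio 0 := fun x hx =>
    hx.2.trans (by simpa using hr)
  calc ENNReal.ofReal (Real.exp (-2) * (1 / (2 * r)) ^ (2 * β + 4) / stripVol E (-(1 / r)))
      = ENNReal.ofReal (Real.exp (-2) * (1 / (2 * r)) ^ (2 * β + 3) / stripVol E (-(1 / r))) *
          volume (Ioo (-(1 / r)) (-(1 / (2 * r)))) := by
        rw [Real.volume_Ioo, hlen, ← ENNReal.ofReal_mul (by positivity),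
          show 2 * β + 4 = (2 * β + 3) + 1 by ring, Real.rpow_add_one (by positivity)]
        congr 1
        ring
    _ = ∫⁻ _ in Ioo (-(1 / r)) (-(1 / (2 * r))), ENNReal.ofReal
          (Real.exp (-2) * (1 / (2 * r)) ^ (2 * β + 3) / stripVol E (-(1 / r))) :=
        (setLIntegral_const _ _).symm
    _ ≤ ∫⁻ x in Ioo (-(1 / r)) (-(1 / (2 * r))),
          ENNReal.ofReal (Real.exp (2 * r * x) * |x| ^ (2 * β + 3) / stripVol E x) := by
        refine setLIntegral_mono' measurableSet_Ioo fun x hx => ENNReal.ofReal_le_ofReal ?_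
        have hx0 : x < 0 := hsub hx
        have hsx := stripVol_pos hE hx0
        have hle := stripVol_antitone hE hx.1.le
        have h1 : -2 ≤ 2 * r * x := by
          calc (-2 : ℝ) = 2 * r * (-(1 / r)) := by field_simp
            _ ≤ 2 * r * x := by have := hx.1.le; gcongr
        have h2 : 1 / (2 * r) ≤ |x| := by
          rw [abs_of_neg hx0]
          linarith [hx.2]
        have h3 : (1 / (2 * r)) ^ (2 * β + 3) ≤ |x| ^ (2 * β + 3) :=
          Real.rpow_le_rpow (by positivity) h2 (by linarith)
        have h4 := Real.exp_le_exp.2 h1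
        gcongr
    _ ≤ _ := lintegral_mono_set hsub

/-- The constant in the upper bound of `stripWeight`. -/
noncomputable def weightConst (β : ℝ) : ℝ :=
  (1 / 2) ^ (2 * β + 4) * Real.Gamma (2 * β + 4) + (1 / 2) ^ (2 * β + 2) * Real.Gamma (2 * β + 2)

theorem weightConst_pos {β : ℝ} (hβ : -(1 / 2 : ℝ) < β) : 0 < weightConst β := by
  have h1 := Real.Gamma_pos_of_pos (s := 2 * β + 4) (by linarith)
  have h2 := Real.Gamma_pos_of_pos (s := 2 * β + 2) (by linarith)
  unfold weightConst
  positivity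

theorem lintegral_rpow_mul_exp {a r : ℝ} (ha : 0 < a) (hr : 0 < r) :
    ∫⁻ t in Ioi (0 : ℝ), ENNReal.ofReal (t ^ (a - 1) * Real.exp (-(r * t))) =
      ENNReal.ofReal ((1 / r) ^ a * Real.Gamma a) := by
  rw [← Real.integral_rpow_mul_exp_neg_mul_Ioi ha hr, ofReal_integral_eq_lintegral_ofReal]
  · have := integrableOn_rpow_mul_exp_neg_mul_rpow (p := 1) (s := a - 1) (b := r)
      (by linarith) one_pos hr
    simpa only [Real.rpow_one, neg_mul, IntegrableOn] using this
  · filter_upwards [ae_restrict_mem measurableSet_Ioi] with t ht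
    have : 0 < t := ht
    positivity

theorem stripWeight_le {E : Set ℂ} (hE : IsLeftDomain E) {β r : ℝ} (hβ : -(1 / 2 : ℝ) < β)
    (hr : 0 < r) :
    stripWeight E β r ≤
      ENNReal.ofReal (weightConst β * (1 / r) ^ (2 * β + 4) / stripVol E (-(1 / r))) := by
  set s₁ := stripVol E (-(1 / r)) with hs₁
  have hs : 0 < s₁ := stripVol_pos hE (by simpa using hr)
  have hinv : ∀ t : ℝ, 0 < t → 1 / stripVol E (-t) ≤ (1 + (1 / (r * t)) ^ 2) / s₁ := by
    intro t ht
    have hst := stripVol_pos hE (t := -t) (by linarith)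
    rw [div_le_div_iff₀ hst hs, one_mul]
    rcases le_total (1 / r) t with h | h
    · have h1 : s₁ ≤ stripVol E (-t) := stripVol_antitone hE (by linarith)
      nlinarith [mul_nonneg (sq_nonneg (1 / (r * t))) hst.le]
    · have h1 := stripVol_mul_le hE (c := 1 / (r * t))
        (by rw [le_div_iff₀ (by positivity), one_mul]; rwa [le_div_iff₀ hr, mul_comm] at h) (-t)
      have h2 : 1 / (r * t) * -t = -(1 / r) := by field_simp
      rw [h2] at h1
      linarith
  have hpt : ∀ t ∈ Ioi (0 : ℝ),
      ENNReal.ofReal (Real.exp (2 * r * -t) * |-t| ^ (2 * β + 3) / stripVol E (-t)) ≤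
      ENNReal.ofReal (1 / s₁) * (ENNReal.ofReal (t ^ (2 * β + 4 - 1) * Real.exp (-(2 * r * t))) +
        ENNReal.ofReal ((1 / r) ^ 2) *
          ENNReal.ofReal (t ^ (2 * β + 2 - 1) * Real.exp (-(2 * r * t)))) := by
    intro t ht
    have ht' : 0 < t := ht
    rw [← ENNReal.ofReal_mul (by positivity), ← ENNReal.ofReal_add (by positivity) (by positivity),
      ← ENNReal.ofReal_mul (by positivity)]
    refine ENNReal.ofReal_le_ofReal ?_
    have e1 : t ^ (2 * β + 4 - 1) = t ^ (2 * β + 2 - 1) * t ^ 2 := by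
      rw [← Real.rpow_natCast t 2, ← Real.rpow_add ht']
      congr 1
      push_cast
      ring
    have e2 : 2 * β + 3 = 2 * β + 4 - 1 := by ring
    rw [abs_neg, abs_of_pos ht', e2, e1, show 2 * r * -t = -(2 * r * t) by ring]
    calc Real.exp (-(2 * r * t)) * (t ^ (2 * β + 2 - 1) * t ^ 2) / stripVol E (-t)
        = Real.exp (-(2 * r * t)) * (t ^ (2 * β + 2 - 1) * t ^ 2) * (1 / stripVol E (-t)) := by
          ring
      _ ≤ Real.exp (-(2 * r * t)) * (t ^ (2 * β + 2 - 1) * t ^ 2) *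
            ((1 + (1 / (r * t)) ^ 2) / s₁) := by
          have := hinv t ht'
          gcongr
      _ = _ := by field_simp
  have hmeas : ∀ a : ℝ, Measurable fun t : ℝ =>
      ENNReal.ofReal (t ^ (a - 1) * Real.exp (-(2 * r * t))) := fun a => by fun_prop
  have hchange : stripWeight E β r = ∫⁻ t in Ioi (0 : ℝ),
      ENNReal.ofReal (Real.exp (2 * r * -t) * |-t| ^ (2 * β + 3) / stripVol E (-t)) := by
    have h := (Measure.measurePreserving_neg (volume : Measure ℝ)).setLIntegral_comp_emb
      (Homeomorph.neg ℝ).measurableEmbedding (fun x =>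
        ENNReal.ofReal (Real.exp (2 * r * x) * |x| ^ (2 * β + 3) / stripVol E x)) (Ioi 0)
    rw [stripWeight, h]
    simp
  rw [hchange]
  refine (setLIntegral_mono' measurableSet_Ioi hpt).trans (le_of_eq ?_)
  rw [lintegral_const_mul' _ _ ENNReal.ofReal_ne_top,
    lintegral_add_left (hmeas _), lintegral_const_mul _ (hmeas _),
    lintegral_rpow_mul_exp (by linarith) (by positivity),
    lintegral_rpow_mul_exp (by linarith) (by positivity)]
  have g1 := Real.Gamma_pos_of_pos (s := 2 * β + 4) (by linarith)
  have g2 := Real.Gamma_pos_of_pos (s := 2 * β + 2) (by linarith)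
  rw [← ENNReal.ofReal_mul (by positivity), ← ENNReal.ofReal_add (by positivity) (by positivity),
    ← ENNReal.ofReal_mul (by positivity)]
  congr 1
  have e3 : ∀ a : ℝ, (1 / (2 * r)) ^ a = (1 / 2) ^ a * (1 / r) ^ a := fun a => by
    rw [← Real.mul_rpow (by positivity) (by positivity)]
    congr 1
    field_simp
  have e4 : (1 / r) ^ (2 * β + 4) = (1 / r) ^ 2 * (1 / r) ^ (2 * β + 2) := by
    rw [← Real.rpow_natCast (1 / r) 2, ← Real.rpow_add (by positivity)]
    congr 1
    push_cast
    ring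
  rw [e3, e3, weightConst, e4]
  ring

/-- The weights of the two integrals are comparable: `r⁴ J(r) ≍ 1 / (k(r) r^{2β})`. -/
theorem weight_comparison {E : Set ℂ} (hE : IsLeftDomain E) {β r : ℝ} (hβ : -(1 / 2 : ℝ) < β)
    (hr : 0 < r) :
    ENNReal.ofReal (Real.exp (-2) ^ 2 * (1 / 2) ^ (2 * β + 4)) *
        ENNReal.ofReal (1 / (expMass E r * r ^ (2 * β))) ≤
      ENNReal.ofReal (r ^ 4) * stripWeight E β r ∧
    ENNReal.ofReal (r ^ 4) * stripWeight E β r ≤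
      ENNReal.ofReal (weightConst β * massConst) *
        ENNReal.ofReal (1 / (expMass E r * r ^ (2 * β))) := by
  have hs := stripVol_pos hE (t := -(1 / r)) (by simpa using hr)
  have hk := expMass_pos hE hr
  have hk1 := le_expMass hE hr
  have hk2 := expMass_le hE hr
  have hw := weightConst_pos hβ
  have hm := massConst_pos
  have hrb : 0 < r ^ (2 * β) := by positivity
  have e : r ^ 4 * (1 / r) ^ (2 * β + 4) = 1 / r ^ (2 * β) := by
    rw [one_div, Real.inv_rpow hr.le, ← Real.rpow_neg hr.le, ← Real.rpow_natCast r 4,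
      ← Real.rpow_add hr, one_div, ← Real.rpow_neg hr.le]
    congr 1
    push_cast
    ring
  constructor
  · refine le_trans ?_ (mul_le_mul_right (le_stripWeight hE hβ hr) _)
    rw [← ENNReal.ofReal_mul (by positivity), ← ENNReal.ofReal_mul (by positivity)]
    refine ENNReal.ofReal_le_ofReal ?_
    have e' : (1 / (2 * r)) ^ (2 * β + 4) = (1 / 2) ^ (2 * β + 4) * (1 / r) ^ (2 * β + 4) := by
      rw [← Real.mul_rpow (by positivity) (by positivity)]
      congr 1
      field_simp
    have h1 : Real.exp (-2) / expMass E r ≤ 1 / stripVol E (-(1 / r)) := by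
      rw [div_le_div_iff₀ hk hs, one_mul]
      exact hk1
    calc Real.exp (-2) ^ 2 * (1 / 2) ^ (2 * β + 4) * (1 / (expMass E r * r ^ (2 * β)))
        = Real.exp (-2) * (1 / 2) ^ (2 * β + 4) * (1 / r ^ (2 * β)) *
            (Real.exp (-2) / expMass E r) := by field_simp
      _ ≤ Real.exp (-2) * (1 / 2) ^ (2 * β + 4) * (1 / r ^ (2 * β)) *
            (1 / stripVol E (-(1 / r))) := by gcongr
      _ = _ := by rw [e', ← e]; ring
  · refine (mul_le_mul_right (stripWeight_le hE hβ hr) _).trans ?_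
    rw [← ENNReal.ofReal_mul (by positivity), ← ENNReal.ofReal_mul (by positivity)]
    refine ENNReal.ofReal_le_ofReal ?_
    have h1 : 1 / stripVol E (-(1 / r)) ≤ massConst / expMass E r := by
      rw [div_le_div_iff₀ hs hk, one_mul]
      exact hk2
    calc r ^ 4 * (weightConst β * (1 / r) ^ (2 * β + 4) / stripVol E (-(1 / r)))
        = weightConst β * (1 / r ^ (2 * β)) * (1 / stripVol E (-(1 / r))) := by rw [← e]; ring
      _ ≤ weightConst β * (1 / r ^ (2 * β)) * (massConst / expMass E r) := by gcongr
      _ = _ := by field_simp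

/-! ### Laplace integrals -/

/-- The Laplace integral `∫_0^∞ rⁿ f(r) e^{-rw} dr`. -/
noncomputable def laplaceMoment (f : ℝ → ℂ) (n : ℕ) (w : ℂ) : ℂ :=
  ∫ r in Ioi (0 : ℝ), (r : ℂ) ^ n * f r * Complex.exp (-(r * w))

/-- All Laplace integrals of `f` converge absolutely in the half-plane `Re w > h`. -/
def HasLaplaceMoments (f : ℝ → ℂ) (h : ℝ) : Prop :=
  ∀ (n : ℕ) (c : ℝ), h < c →
    IntegrableOn (fun r : ℝ => r ^ n * ‖f r‖ * Real.exp (-(r * c))) (Ioi 0)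

theorem norm_laplace_integrand {f : ℝ → ℂ} (n : ℕ) (w : ℂ) {r : ℝ} (hr : 0 < r) :
    ‖(r : ℂ) ^ n * f r * Complex.exp (-(r * w))‖ = r ^ n * ‖f r‖ * Real.exp (-(r * w.re)) := by
  rw [norm_mul, norm_mul, norm_pow, Complex.norm_real, Real.norm_of_nonneg hr.le,
    Complex.norm_exp, Complex.neg_re, Complex.re_ofReal_mul]

theorem HasLaplaceMoments.integrableOn {f : ℝ → ℂ} {h : ℝ} (hL : HasLaplaceMoments f h)
    (hf : Continuous f) (n : ℕ) {w : ℂ} (hw : h < w.re) :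
    IntegrableOn (fun r : ℝ => (r : ℂ) ^ n * f r * Complex.exp (-(r * w))) (Ioi 0) := by
  have hcont : Continuous fun r : ℝ => (r : ℂ) ^ n * f r * Complex.exp (-(r * w)) := by fun_prop
  refine (hL n w.re hw).mono' hcont.aestronglyMeasurable ?_
  filter_upwards [ae_restrict_mem measurableSet_Ioi] with r hr
  exact (norm_laplace_integrand n w hr).le

theorem HasLaplaceMoments.hasDerivAt {f : ℝ → ℂ} {h : ℝ} (hL : HasLaplaceMoments f h)
    (hf : Continuous f) (n : ℕ) {w : ℂ} (hw : h < w.re) :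
    HasDerivAt (laplaceMoment f n) (-laplaceMoment f (n + 1) w) w := by
  obtain ⟨c, hc, hcw⟩ := exists_between hw
  have hs : {z : ℂ | c < z.re} ∈ nhds w :=
    (isOpen_lt continuous_const Complex.continuous_re).mem_nhds hcw
  have hcont : ∀ (n : ℕ) (w : ℂ), Continuous fun r : ℝ =>
      (r : ℂ) ^ n * f r * Complex.exp (-(r * w)) := fun n w => by fun_prop
  have key := (hasDerivAt_integral_of_dominated_loc_of_deriv_le
    (μ := volume.restrict (Ioi (0 : ℝ)))
    (F := fun (w : ℂ) (r : ℝ) => (r : ℂ) ^ n * f r * Complex.exp (-(r * w)))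
    (F' := fun (w : ℂ) (r : ℝ) => -((r : ℂ) ^ (n + 1) * f r * Complex.exp (-(r * w))))
    (bound := fun r : ℝ => r ^ (n + 1) * ‖f r‖ * Real.exp (-(r * c))) hs
    (Filter.Eventually.of_forall fun z => (hcont n z).aestronglyMeasurable)
    (hL.integrableOn hf n hw) (hcont (n + 1) w).neg.aestronglyMeasurable
    ?_ (hL (n + 1) c hc) ?_).2
  · rwa [integral_neg] at key
  · filter_upwards [ae_restrict_mem measurableSet_Ioi] with r hr z hz
    have hr' : 0 < r := hr
    have hz' : c < z.re := hz
    rw [norm_neg, norm_laplace_integrand _ _ hr']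
    gcongr
  · refine Filter.Eventually.of_forall fun r z _ => ?_
    have h1 : HasDerivAt (fun z : ℂ => -((r : ℂ) * z)) (-(r : ℂ)) z := by
      simpa using ((hasDerivAt_id' z).const_mul (r : ℂ)).fun_neg
    convert! (h1.cexp.const_mul ((r : ℂ) ^ n * f r)) using 1
    ring

theorem measurable_laplaceMoment {f : ℝ → ℂ} (hf : Continuous f) (n : ℕ) :
    Measurable (laplaceMoment f n) := by
  have hcont : Continuous fun p : ℂ × ℝ =>
      (p.2 : ℂ) ^ n * f p.2 * Complex.exp (-(p.2 * p.1)) := by fun_prop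
  exact (hcont.stronglyMeasurable.integral_prod_right'
    (ν := volume.restrict (Ioi (0 : ℝ)))).measurable

theorem integral_pow_mul_exp_neg {ρ : ℝ} (hρ : 0 < ρ) (k : ℕ) :
    IntegrableOn (fun r : ℝ => r ^ k * Real.exp (-(ρ * r))) (Ioi 0) ∧
      ∫ r in Ioi (0 : ℝ), r ^ k * Real.exp (-(ρ * r)) = k.factorial / ρ ^ (k + 1) := by
  constructor
  · have := integrableOn_rpow_mul_exp_neg_mul_rpow (p := 1) (s := k) (b := ρ)
      (by have : (0 : ℝ) ≤ k := k.cast_nonneg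
          linarith) one_pos hρ
    simpa only [Real.rpow_one, neg_mul, Real.rpow_natCast] using this
  · have := Real.integral_rpow_mul_exp_neg_mul_Ioi (a := k + 1) (r := ρ) (by positivity) hρ
    rw [Real.Gamma_nat_eq_factorial] at this
    simp only [add_sub_cancel_right, Real.rpow_natCast] at this
    rw [this, ← Nat.cast_add_one, Real.rpow_natCast, one_div, inv_pow]
    ring

/-! ### The Borel transform near infinity -/

theorem HasExpType.eq_zero_of_neg {F : ℂ → ℂ} {σ : ℝ} (hF : HasExpType F σ) (hσ : σ < 0) :
    F = 0 := by
  obtain ⟨τ, hτ, hτ0⟩ := exists_between hσ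
  obtain ⟨C, hC⟩ := hF.bound τ hτ
  have hlim : Filter.Tendsto (fun z : ℂ => C * Real.exp (τ * ‖z‖))
      (Filter.cocompact ℂ) (nhds 0) := by
    have h1 : Filter.Tendsto (fun z : ℂ => τ * ‖z‖) (Filter.cocompact ℂ) Filter.atBot :=
      (tendsto_norm_cocompact_atTop (E := ℂ)).const_mul_atTop_of_neg hτ0
    simpa using (Real.tendsto_exp_atBot.comp h1).const_mul C
  funext z
  exact hF.entire.apply_eq_of_tendsto_cocompact z (squeeze_zero_norm hC hlim)

/-- The Taylor coefficients of a function of exponential type grow at most geometrically. The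
bound is the Cauchy estimate on the circle of radius `R`, integrated against `e^{-ρR} dR`. -/
theorem HasExpType.exists_norm_iteratedDeriv_le {F : ℂ → ℂ} {σ ρ : ℝ} (hF : HasExpType F σ)
    (hρ0 : 0 < ρ) (hρ : σ < ρ) : ∃ M : ℝ, ∀ k : ℕ, ‖iteratedDeriv k F 0‖ ≤ M * ρ ^ (k + 1) := by
  obtain ⟨τ, hτ, hτρ⟩ := exists_between hρ
  obtain ⟨C, hC⟩ := hF.bound τ hτ
  have hint := integral_pow_mul_exp_neg (sub_pos.2 hτρ) 0
  refine ⟨∫ R in Ioi (0 : ℝ), C * (R ^ 0 * Real.exp (-((ρ - τ) * R))), fun k => ?_⟩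
  have hkint := integral_pow_mul_exp_neg hρ0 k
  have hfac : (0 : ℝ) < k.factorial := by exact_mod_cast k.factorial_pos
  have hle : ∫ R in Ioi (0 : ℝ), ‖iteratedDeriv k F 0‖ / k.factorial *
        (R ^ k * Real.exp (-(ρ * R))) ≤
      ∫ R in Ioi (0 : ℝ), C * (R ^ 0 * Real.exp (-((ρ - τ) * R))) := by
    refine setIntegral_mono_on (hkint.1.const_mul _) (hint.1.const_mul _) measurableSet_Ioi
      fun R hR => ?_
    have hR' : 0 < R := hR
    have hcauchy := Complex.norm_iteratedDeriv_le_of_forall_mem_sphere_norm_le (c := 0)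
      (C := C * Real.exp (τ * R)) k hR' hF.entire.diffContOnCl fun z hz => by
        have : ‖z‖ = R := by simpa using hz
        simpa [this] using hC z
    rw [le_div_iff₀ (by positivity)] at hcauchy
    have hsplit : Real.exp (-((ρ - τ) * R)) = Real.exp (τ * R) * Real.exp (-(ρ * R)) := by
      rw [← Real.exp_add]
      congr 1
      ring
    calc ‖iteratedDeriv k F 0‖ / k.factorial * (R ^ k * Real.exp (-(ρ * R)))
        = (‖iteratedDeriv k F 0‖ * R ^ k) * Real.exp (-(ρ * R)) / k.factorial := by ring
      _ ≤ (k.factorial * (C * Real.exp (τ * R))) * Real.exp (-(ρ * R)) / k.factorial := by gcongr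
      _ = C * (R ^ 0 * Real.exp (-((ρ - τ) * R))) := by
          rw [hsplit]
          field_simp
  rw [integral_const_mul, hkint.2] at hle
  rw [← div_le_iff₀ (by positivity)]
  calc ‖iteratedDeriv k F 0‖ / ρ ^ (k + 1)
      = ‖iteratedDeriv k F 0‖ / k.factorial * (k.factorial / ρ ^ (k + 1)) := by field_simp
    _ ≤ _ := hle

/-- The Borel transform of `F` as a series around infinity. -/
noncomputable def borelSeries (F : ℂ → ℂ) (z : ℂ) : ℂ := ∑' k : ℕ, iteratedDeriv k F 0 / z ^ (k + 1)

theorem HasExpType.exists_summable_bound {F : ℂ → ℂ} {σ ρ : ℝ} (hF : HasExpType F σ)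
    (hσ : 0 ≤ σ) (hρ : σ < ρ) :
    ∃ u : ℕ → ℝ, Summable u ∧ ∀ k (z : ℂ), ρ ≤ ‖z‖ → ‖iteratedDeriv k F 0 / z ^ (k + 1)‖ ≤ u k := by
  obtain ⟨ρ', h1, h2⟩ := exists_between hρ
  have hρ'0 : 0 < ρ' := hσ.trans_lt h1
  have hρ0 : 0 < ρ := hρ'0.trans h2
  obtain ⟨M, hM⟩ := hF.exists_norm_iteratedDeriv_le hρ'0 h1
  refine ⟨fun k => M * (ρ' / ρ) ^ (k + 1), ?_, fun k z hz => ?_⟩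
  · have := summable_geometric_of_lt_one (by positivity) ((div_lt_one hρ0).2 h2)
    exact ((summable_nat_add_iff 1).2 this).mul_left M
  · change _ ≤ M * (ρ' / ρ) ^ (k + 1)
    rw [norm_div, norm_pow, div_pow, ← mul_div_assoc]
    have := (norm_nonneg _).trans (hM k)
    gcongr
    exact hM k

theorem HasExpType.hasSum_borelSeries {F : ℂ → ℂ} {σ : ℝ} (hF : HasExpType F σ) (hσ : 0 ≤ σ)
    {z : ℂ} (hz : σ < ‖z‖) :
    HasSum (fun k : ℕ => iteratedDeriv k F 0 / z ^ (k + 1)) (borelSeries F z) := by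
  obtain ⟨u, hu, hle⟩ := hF.exists_summable_bound hσ hz
  exact (Summable.of_norm_bounded hu fun k => hle k z le_rfl).hasSum

theorem HasExpType.differentiableOn_borelSeries {F : ℂ → ℂ} {σ : ℝ} (hF : HasExpType F σ)
    (hσ : 0 ≤ σ) : DifferentiableOn ℂ (borelSeries F) {z | σ < ‖z‖} := by
  intro z hz
  obtain ⟨ρ, h1, h2⟩ := exists_between (show σ < ‖z‖ from hz)
  obtain ⟨u, hu, hle⟩ := hF.exists_summable_bound hσ h1
  have hopen : IsOpen {z : ℂ | ρ < ‖z‖} := isOpen_lt continuous_const continuous_norm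
  have hdiff : DifferentiableOn ℂ (borelSeries F) {z | ρ < ‖z‖} := by
    refine Complex.differentiableOn_tsum_of_summable_norm hu (fun k => ?_) hopen
      fun k w hw => hle k w (le_of_lt hw)
    refine (differentiableOn_const _).div (differentiableOn_id.pow _) fun w hw => ?_
    have hw' : ρ < ‖w‖ := hw
    have : w ≠ 0 := norm_pos_iff.1 ((hσ.trans h1.le).trans_lt hw')
    exact pow_ne_zero _ this
  exact (hdiff.differentiableAt (hopen.mem_nhds h2)).differentiableWithinAt

/-- The Laplace representation of the Borel transform on the ray through `e⁻¹`, by termwise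
integration of the Taylor series. -/
theorem HasExpType.laplaceMoment_eq_borelSeries {F : ℂ → ℂ} {σ : ℝ} (hF : HasExpType F σ)
    (hσ : 0 ≤ σ) {e : ℂ} (he : ‖e‖ = 1) {x : ℝ} (hx : σ < x) :
    e * laplaceMoment (fun r => F (r * e)) 0 x = borelSeries F (x * e⁻¹) := by
  have hx0 : 0 < x := hσ.trans_lt hx
  have he0 : e ≠ 0 := norm_ne_zero_iff.1 (by simp [he])
  have hnorm : ‖(x : ℂ) * e⁻¹‖ = x := by simp [he, abs_of_pos hx0]
  obtain ⟨u, hu, hle⟩ := hF.exists_summable_bound hσ hx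
  let T : ℕ → ℝ → ℂ := fun k r =>
    (iteratedDeriv k F 0 * e ^ k / k.factorial) * ((r ^ k * Real.exp (-(x * r)) : ℝ) : ℂ)
  have hTint : ∀ k, IntegrableOn (T k) (Ioi 0) := fun k =>
    (integral_pow_mul_exp_neg hx0 k).1.ofReal.const_mul _
  have hfac : ∀ k : ℕ, (k.factorial : ℂ) ≠ 0 := fun k => by exact_mod_cast k.factorial_ne_zero
  have hTval : ∀ k, e * ∫ r in Ioi (0 : ℝ), T k r =
      iteratedDeriv k F 0 / ((x : ℂ) * e⁻¹) ^ (k + 1) := by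
    intro k
    have hxc : (x : ℂ) ≠ 0 := by exact_mod_cast hx0.ne'
    have := hfac k
    rw [integral_const_mul, integral_complex_ofReal, (integral_pow_mul_exp_neg hx0 k).2]
    push_cast
    rw [mul_pow, inv_pow]
    field_simp
    ring
  have hTnorm : ∀ k, ∫ r in Ioi (0 : ℝ), ‖T k r‖ =
      ‖iteratedDeriv k F 0 / ((x : ℂ) * e⁻¹) ^ (k + 1)‖ := by
    intro k
    have h1 : ∀ r ∈ Ioi (0 : ℝ), ‖T k r‖ =
        ‖iteratedDeriv k F 0‖ / k.factorial * (r ^ k * Real.exp (-(x * r))) := by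
      intro r hr
      have hr' : 0 < r := hr
      simp only [T]
      rw [norm_mul, norm_div, norm_mul, norm_pow, he, Complex.norm_real,
        Real.norm_of_nonneg (by positivity), Complex.norm_natCast]
      simp
    rw [setIntegral_congr_fun measurableSet_Ioi h1, integral_const_mul,
      (integral_pow_mul_exp_neg hx0 k).2, norm_div, norm_pow, hnorm]
    field_simp
  have hsum : Summable fun k => ∫ r in Ioi (0 : ℝ), ‖T k r‖ := by
    refine Summable.of_norm_bounded hu fun k => ?_
    rw [hTnorm, norm_norm]
    exact hle k _ hnorm.ge
  have h := (hasSum_integral_of_summable_integral_norm hTint hsum).mul_left e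
  have hpt : ∀ r : ℝ, ∑' k, T k r = (r : ℂ) ^ 0 * F (r * e) * Complex.exp (-(r * x)) := by
    intro r
    have ht := (Complex.hasSum_taylorSeries_of_entire hF.entire 0 (r * e)).mul_right
      (Complex.exp (-(r * x)))
    rw [pow_zero, one_mul, ← ht.tsum_eq]
    refine tsum_congr fun k => ?_
    simp only [T, sub_zero, smul_eq_mul]
    push_cast
    rw [mul_pow, mul_comm (x : ℂ)]
    ring
  simp only [hpt] at h
  rw [laplaceMoment, borelSeries, ← h.tsum_eq]
  exact tsum_congr hTval

/-! ### Analytic continuation to the half-plane -/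

/-- The part of a half-plane outside a disc is connected: from any of its points one can go
vertically away from the real axis, then horizontally, then vertically along a line to the right
of the disc. -/
theorem isPreconnected_halfPlane_diff_disc (h σ : ℝ) :
    IsPreconnected {w : ℂ | h < w.re ∧ σ < ‖w‖} := by
  set b : ℝ := max h σ + 1 with hb
  have hbh : h < b := by have := le_max_left h σ; linarith
  have hbσ : σ < b := by have := le_max_right h σ; linarith
  refine isPreconnected_of_forall (b : ℂ) fun w ⟨hwh, hwσ⟩ => ?_
  obtain ⟨Y, hY, hYw⟩ : ∃ Y : ℝ, σ < |Y| ∧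
      ∀ θ ∈ Icc (0 : ℝ) 1, w.im ^ 2 ≤ (w.im + θ * (Y - w.im)) ^ 2 := by
    rcases le_total 0 w.im with hi | hi
    · refine ⟨w.im + |σ| + 1, ?_, fun θ hθ => ?_⟩
      · exact lt_of_lt_of_le (by linarith [le_abs_self σ]) (le_abs_self _)
      · have : 0 ≤ θ * (w.im + |σ| + 1 - w.im) :=
          mul_nonneg hθ.1 (by linarith [abs_nonneg σ])
        nlinarith
    · refine ⟨w.im - |σ| - 1, ?_, fun θ hθ => ?_⟩
      · exact lt_of_lt_of_le (by linarith [le_abs_self σ]) (neg_le_abs _)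
      · have : 0 ≤ θ * (w.im - (w.im - |σ| - 1)) :=
          mul_nonneg hθ.1 (by linarith [abs_nonneg σ])
        nlinarith
  let p : ℂ := ⟨w.re, Y⟩
  let q : ℂ := ⟨b, Y⟩
  have hpre : ∀ x y : ℂ, IsPreconnected (segment ℝ x y) := fun x y =>
    (convex_segment x y).isPreconnected
  refine ⟨segment ℝ w p ∪ segment ℝ p q ∪ segment ℝ q b, ?_, ?_, ?_, ?_⟩
  · rintro z ((hz | hz) | hz) <;> rw [segment_eq_image'] at hz <;> obtain ⟨θ, hθ, rfl⟩ := hz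
    · have hre : (w + θ • (p - w)).re = w.re := by simp [p]
      have him : (w + θ • (p - w)).im = w.im + θ * (Y - w.im) := by simp [p]
      refine ⟨by rw [hre]; exact hwh, hwσ.trans_le ?_⟩
      rw [Complex.norm_eq_sqrt_sq_add_sq, Complex.norm_eq_sqrt_sq_add_sq, hre, him]
      have := hYw θ hθ
      gcongr
    · have hre : (p + θ • (q - p)).re = w.re + θ * (b - w.re) := by simp [p, q]
      have him : (p + θ • (q - p)).im = Y := by simp [p, q]
      refine ⟨?_, ?_⟩
      · rw [mem_Icc] at hθ
        rw [hre]
        nlinarith [mul_nonneg hθ.1 (sub_pos.2 hbh).le,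
          mul_nonneg (sub_nonneg.2 hθ.2) (sub_pos.2 hwh).le]
      · exact hY.trans_le (him ▸ Complex.abs_im_le_norm _)
    · have hre : (q + θ • ((b : ℂ) - q)).re = b := by simp [q]
      refine ⟨by rw [hre]; exact hbh, ?_⟩
      have hle := Complex.abs_re_le_norm (q + θ • ((b : ℂ) - q))
      rw [hre] at hle
      exact hbσ.trans_le ((le_abs_self b).trans hle)
  · exact Or.inr (right_mem_segment _ _ _)
  · exact Or.inl (Or.inl (left_mem_segment _ _ _))
  · refine IsPreconnected.union q ?_ (left_mem_segment _ _ _)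
      (IsPreconnected.union p (right_mem_segment _ _ _) (left_mem_segment _ _ _)
        (hpre _ _) (hpre _ _)) (hpre _ _)
    exact Or.inr (right_mem_segment _ _ _)

theorem isOpen_halfPlane (D : Set ℂ) (φ : ℝ) : IsOpen (halfPlane D φ) :=
  isOpen_lt continuous_const (by fun_prop)

theorem norm_exp_I_mul (φ : ℝ) : ‖Complex.exp (Complex.I * φ)‖ = 1 := by
  rw [mul_comm]
  exact Complex.norm_exp_ofReal_mul_I φ

/-- The Borel transform on the half-plane, as a Laplace integral along the ray of direction
`e^{iφ}`. -/
noncomputable def rayBorel (F : ℂ → ℂ) (φ : ℝ) (z : ℂ) : ℂ :=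
  Complex.exp (Complex.I * φ) *
    laplaceMoment (fun r => F (r * Complex.exp (Complex.I * φ))) 0
      (z * Complex.exp (Complex.I * φ))

/-- The Laplace integral continues the Borel series into the half-plane. -/
theorem isBorelTransformOn_rayBorel {D : Set ℂ} {φ σ : ℝ} {F : ℂ → ℂ} (hF : HasExpType F σ)
    (hL : HasLaplaceMoments (fun r => F (r * Complex.exp (Complex.I * φ))) (supportFn D φ)) :
    IsBorelTransformOn F σ (halfPlane D φ) (rayBorel F φ) := by
  set e := Complex.exp (Complex.I * φ) with he
  set h := supportFn D φ
  have he1 : ‖e‖ = 1 := norm_exp_I_mul φ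
  have he0 : e ≠ 0 := Complex.exp_ne_zero _
  have hcont : Continuous fun r : ℝ => F (r * e) := hF.entire.continuous.comp (by fun_prop)
  have hdiff : DifferentiableOn ℂ (fun w => e * laplaceMoment (fun r => F (r * e)) 0 w)
      {w | h < w.re} := fun w hw =>
    ((hL.hasDerivAt hcont 0 hw).differentiableAt.const_mul e).differentiableWithinAt
  refine ⟨?_, fun z hz hzσ => ?_⟩
  · exact hdiff.comp (differentiableOn_id.mul_const e) fun z hz => hz
  · rcases lt_or_ge σ 0 with hσ | hσ
    · have hF0 := hF.eq_zero_of_neg hσ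
      subst hF0
      have h1 : ∀ k : ℕ, iteratedDeriv k (0 : ℂ → ℂ) 0 = 0 := fun k => by
        simp
      simp [h1, rayBorel, laplaceMoment, hasSum_zero]
    · set V : Set ℂ := {w : ℂ | h < w.re ∧ σ < ‖w‖}
      have hV : IsOpen V := (isOpen_lt continuous_const Complex.continuous_re).inter
        (isOpen_lt continuous_const continuous_norm)
      have han1 : AnalyticOnNhd ℂ (fun w => e * laplaceMoment (fun r => F (r * e)) 0 w) V :=
        (hdiff.mono fun w hw => hw.1).analyticOnNhd hV
      have han2 : AnalyticOnNhd ℂ (fun w => borelSeries F (w * e⁻¹)) V := by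
        refine DifferentiableOn.analyticOnNhd ?_ hV
        refine (hF.differentiableOn_borelSeries hσ).comp (differentiableOn_id.mul_const e⁻¹)
          fun w hw => ?_
        simpa [he1] using hw.2
      set b : ℝ := max h σ + 1
      have hbV : (b : ℂ) ∈ V := by
        refine ⟨?_, ?_⟩
        · have := le_max_left h σ
          rw [Complex.ofReal_re]
          linarith
        · have := le_max_right h σ
          rw [Complex.norm_real]
          exact lt_of_lt_of_le (by linarith) (le_abs_self b)
      have hreal : ∀ᶠ x : ℝ in nhdsWithin b {b}ᶜ,
          e * laplaceMoment (fun r => F (r * e)) 0 (x : ℂ) = borelSeries F (x * e⁻¹) := by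
        have hb : σ < b := by have := le_max_right h σ; linarith
        filter_upwards [nhdsWithin_le_nhds (Ioi_mem_nhds hb)] with x hx
        exact hF.laplaceMoment_eq_borelSeries hσ he1 hx
      have htend : Filter.Tendsto (fun x : ℝ => (x : ℂ)) (nhdsWithin b {b}ᶜ)
          (nhdsWithin (b : ℂ) {(b : ℂ)}ᶜ) :=
        Complex.continuous_ofReal.continuousAt.continuousWithinAt.tendsto_nhdsWithin
          fun x hx => by simpa using hx
      have heq := han1.eqOn_of_preconnected_of_frequently_eq han2
        (isPreconnected_halfPlane_diff_disc h σ) hbV (htend.frequently hreal.frequently)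
      have hzV : z * e ∈ V := ⟨hz, by simpa [he1] using hzσ⟩
      have hval : rayBorel F φ z = borelSeries F z := by
        have := heq hzV
        change e * laplaceMoment (fun r => F (r * e)) 0 (z * e) = _
        simpa [mul_assoc, mul_inv_cancel₀ he0] using this
      rw [hval]
      exact hF.hasSum_borelSeries hσ hzσ

theorem IsBorelTransformOn.eqOn {D : Set ℂ} {φ σ : ℝ} {F γ₁ γ₂ : ℂ → ℂ}
    (h₁ : IsBorelTransformOn F σ (halfPlane D φ) γ₁)
    (h₂ : IsBorelTransformOn F σ (halfPlane D φ) γ₂) : EqOn γ₁ γ₂ (halfPlane D φ) := by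
  have hU := isOpen_halfPlane D φ
  have hconv : Convex ℝ (halfPlane D φ) := by
    refine convex_halfSpace_gt ⟨fun x y => ?_, fun c x => ?_⟩ _
    · simp [add_mul]
    · rw [smul_mul_assoc, Complex.smul_re]
  set b : ℝ := max (supportFn D φ) σ + 1
  have hb1 : supportFn D φ < b := by have := le_max_left (supportFn D φ) σ; linarith
  have hb2 : σ < b := by have := le_max_right (supportFn D φ) σ; linarith
  set z₀ : ℂ := b * (Complex.exp (Complex.I * φ))⁻¹
  have hz₀ : z₀ ∈ halfPlane D φ := by
    change supportFn D φ < (z₀ * Complex.exp (Complex.I * φ)).re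
    rw [inv_mul_cancel_right₀ (Complex.exp_ne_zero _), Complex.ofReal_re]
    exact hb1
  have hz₀σ : σ < ‖z₀‖ := by
    rw [norm_mul, norm_inv, norm_exp_I_mul, inv_one, mul_one, Complex.norm_real]
    exact hb2.trans_le (le_abs_self b)
  refine (h₁.analytic.analyticOnNhd hU).eqOn_of_preconnected_of_eventuallyEq
    (h₂.analytic.analyticOnNhd hU) hconv.isPreconnected hz₀ ?_
  filter_upwards [hU.mem_nhds hz₀, (isOpen_lt continuous_const continuous_norm).mem_nhds hz₀σ]
    with z hz hzσ
  exact (h₁.series z hz hzσ).unique (h₂.series z hz hzσ)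

theorem norm_iteratedDeriv_two_rayBorel {D : Set ℂ} {φ : ℝ} {F : ℂ → ℂ} (hF : Continuous F)
    (hL : HasLaplaceMoments (fun r => F (r * Complex.exp (Complex.I * φ))) (supportFn D φ))
    {z : ℂ} (hz : z ∈ halfPlane D φ) :
    ‖iteratedDeriv 2 (rayBorel F φ) z‖ =
      ‖laplaceMoment (fun r => F (r * Complex.exp (Complex.I * φ))) 2
        (z * Complex.exp (Complex.I * φ))‖ := by
  set e := Complex.exp (Complex.I * φ) with he
  set f : ℝ → ℂ := fun r => F (r * e)
  have he1 : ‖e‖ = 1 := norm_exp_I_mul φ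
  have hcont : Continuous f := hF.comp (by fun_prop)
  have hd : ∀ (n : ℕ) (z : ℂ), z ∈ halfPlane D φ →
      HasDerivAt (fun z => laplaceMoment f n (z * e)) (-laplaceMoment f (n + 1) (z * e) * e) z := by
    intro n z hz
    have h1 : HasDerivAt (fun z : ℂ => z * e) e z := by simpa using (hasDerivAt_id z).mul_const e
    exact (hL.hasDerivAt hcont n (w := z * e) hz).comp z h1
  have h1 : deriv (rayBorel F φ) =ᶠ[nhds z]
      fun z => e * (-laplaceMoment f 1 (z * e) * e) := by
    filter_upwards [(isOpen_halfPlane D φ).mem_nhds hz] with w hw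
    exact ((hd 0 w hw).const_mul e).deriv
  have h2 : iteratedDeriv 2 (rayBorel F φ) z = e * (-(-laplaceMoment f 2 (z * e) * e) * e) := by
    rw [iteratedDeriv_succ, iteratedDeriv_one, h1.deriv_eq]
    exact (((hd 1 z hz).neg.mul_const e).const_mul e).deriv
  rw [h2]
  simp [he1]

/-! ### Consequences of the finiteness of the radial integral -/

theorem continuous_ray {F : ℂ → ℂ} (hF : Continuous F) (φ : ℝ) :
    Continuous fun r : ℝ => F (r * Complex.exp (Complex.I * φ)) := hF.comp (by fun_prop)

/-- The integrand of the radial integral in terms of `D_φ`. -/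
noncomputable def rayDensity (E : Set ℂ) (β h : ℝ) (f : ℝ → ℂ) (r : ℝ) : ℝ :=
  ‖f r‖ ^ 2 * Real.exp (-(2 * r * h)) * (1 / (expMass E r * r ^ (2 * β)))

theorem radialIntegral_eq (D : Set ℂ) (β φ : ℝ) (F : ℂ → ℂ) :
    radialIntegral D β φ F = ∫⁻ r in Ioi (0 : ℝ), ENNReal.ofReal
      (rayDensity (rotatedDomain D φ) β (supportFn D φ)
        (fun r => F (r * Complex.exp (Complex.I * φ))) r) := by
  refine lintegral_congr fun r => ?_
  rw [bergmanK_ray, rayDensity, Real.exp_neg]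
  congr 1
  field_simp

theorem rayDensity_nonneg (E : Set ℂ) (β h : ℝ) (f : ℝ → ℂ) {r : ℝ} (hr : 0 < r) :
    0 ≤ rayDensity E β h f r := by
  have : 0 ≤ expMass E r := ENNReal.toReal_nonneg
  unfold rayDensity
  positivity

theorem integrableOn_rayDensity {E : Set ℂ} {β h : ℝ} {f : ℝ → ℂ} (hf : Continuous f)
    (hI : ∫⁻ r in Ioi (0 : ℝ), ENNReal.ofReal (rayDensity E β h f r) < ⊤) :
    IntegrableOn (rayDensity E β h f) (Ioi 0) := by
  have hmeas : Measurable (rayDensity E β h f) := by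
    have h1 : Measurable fun r : ℝ => ‖f r‖ := hf.norm.measurable
    have h2 := measurable_expMass (E := E)
    unfold rayDensity
    fun_prop
  refine ⟨hmeas.aestronglyMeasurable, ?_⟩
  rw [hasFiniteIntegral_iff_ofReal]
  · exact hI
  · filter_upwards [ae_restrict_mem measurableSet_Ioi] with r hr
    exact rayDensity_nonneg E β h f hr

/-- The bound `k(r) ≤ m(E)`, in the form used to dominate the Laplace integrals. -/
theorem norm_sq_mul_exp_le {E : Set ℂ} (hE : IsLeftDomain E) (β h : ℝ) (f : ℝ → ℂ) {r : ℝ}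
    (hr : 0 < r) : ‖f r‖ ^ 2 * Real.exp (-(2 * r * h)) ≤
      rayDensity E β h f r * ((volume E).toReal * r ^ (2 * β)) := by
  have hk := expMass_pos hE hr
  have hkv := expMass_le_volume hE hr
  have hrb : 0 < r ^ (2 * β) := by positivity
  calc ‖f r‖ ^ 2 * Real.exp (-(2 * r * h))
      = rayDensity E β h f r * (expMass E r * r ^ (2 * β)) := by
        rw [rayDensity]
        field_simp
    _ ≤ _ := by
        have := rayDensity_nonneg E β h f hr
        gcongr

/-- Absolute convergence of the Laplace integrals, by the Cauchy–Schwarz inequality in the form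
`2ab ≤ a² + b²`. Since `β > -1/2`, the factor `r^{2β}` is integrable at the origin. -/
theorem hasLaplaceMoments_of_rayDensity {E : Set ℂ} (hE : IsLeftDomain E) {β h : ℝ}
    (hβ : -(1 / 2 : ℝ) < β) {f : ℝ → ℂ} (hf : Continuous f)
    (hint : IntegrableOn (rayDensity E β h f) (Ioi 0)) : HasLaplaceMoments f h := by
  intro n c hc
  have hexp := integrableOn_rpow_mul_exp_neg_mul_rpow (p := 1) (s := 2 * β + 2 * n)
    (b := 2 * (c - h)) (by have : (0 : ℝ) ≤ n := n.cast_nonneg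
                           linarith) one_pos (by linarith)
  have hbound := hint.add (hexp.const_mul (volume E).toReal)
  have hcont : Continuous fun r : ℝ => r ^ n * ‖f r‖ * Real.exp (-(r * c)) := by fun_prop
  refine hbound.mono' hcont.aestronglyMeasurable ?_
  filter_upwards [ae_restrict_mem measurableSet_Ioi] with r hr
  have hr' : 0 < r := hr
  rw [Real.norm_of_nonneg (by positivity)]
  set v := (volume E).toReal
  have hg := rayDensity_nonneg E β h f hr'
  have hle := norm_sq_mul_exp_le hE β h f hr'
  have hw : 0 ≤ v * (r ^ (2 * β + 2 * n) * Real.exp (-(2 * (c - h)) * r)) := by positivity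
  have hsq : (r ^ n * ‖f r‖ * Real.exp (-(r * c))) ^ 2 ≤ rayDensity E β h f r *
      (v * (r ^ (2 * β + 2 * n) * Real.exp (-(2 * (c - h)) * r))) := by
    have e1 : (r ^ n) ^ 2 * r ^ (2 * β) = r ^ (2 * β + 2 * n) := by
      rw [Real.rpow_add hr', mul_comm, ← pow_mul, ← Real.rpow_natCast]
      congr 2
      push_cast
      ring
    have e2 : Real.exp (-(r * c)) ^ 2 =
        Real.exp (-(2 * r * h)) * Real.exp (-(2 * (c - h)) * r) := by
      rw [← Real.exp_nat_mul, ← Real.exp_add]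
      congr 1
      push_cast
      ring
    calc (r ^ n * ‖f r‖ * Real.exp (-(r * c))) ^ 2
        = (‖f r‖ ^ 2 * Real.exp (-(2 * r * h))) *
            ((r ^ n) ^ 2 * Real.exp (-(2 * (c - h)) * r)) := by
          rw [mul_pow, mul_pow, e2]
          ring
      _ ≤ (rayDensity E β h f r * (v * r ^ (2 * β))) *
            ((r ^ n) ^ 2 * Real.exp (-(2 * (c - h)) * r)) := by gcongr
      _ = _ := by
          rw [← e1]
          ring
  simp only [Pi.add_apply, Real.rpow_one]
  refine abs_le_of_sq_le_sq' ?_ (add_nonneg hg hw) |>.2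
  nlinarith [mul_nonneg hg hw]

theorem memLp_laplace_integrand {E : Set ℂ} (hE : IsLeftDomain E) {β h c : ℝ}
    (hβ : -(1 / 2 : ℝ) < β) {f : ℝ → ℂ} (hf : Continuous f)
    (hint : IntegrableOn (rayDensity E β h f) (Ioi 0)) (hc : h < c) :
    MemLp (fun r : ℝ => (r : ℂ) ^ 2 * f r * Complex.exp (-(r * (c : ℂ)))) 2
      (volume.restrict (Ioi 0)) := by
  have hcont : Continuous fun r : ℝ => (r : ℂ) ^ 2 * f r * Complex.exp (-(r * (c : ℂ))) := by
    fun_prop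
  rw [memLp_two_iff_integrable_sq_norm hcont.aestronglyMeasurable]
  -- the factor `r^p e^{-2(c-h)r}` is bounded, because `x ≤ e^x` for `x = δ r`
  set p : ℝ := 2 * β + 4
  have hp : 0 < p := by simp only [p]; linarith
  set δ : ℝ := 2 * (c - h) / p
  have hδ : 0 < δ := div_pos (by linarith) hp
  set v := (volume E).toReal
  refine (hint.mul_const (v * (1 / δ) ^ p)).mono' (by fun_prop) ?_
  filter_upwards [ae_restrict_mem measurableSet_Ioi] with r hr
  have hr' : 0 < r := hr
  have hg := rayDensity_nonneg E β h f hr'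
  have hle := norm_sq_mul_exp_le hE β h f hr'
  have hpow : r ^ p * Real.exp (-(2 * (c - h)) * r) ≤ (1 / δ) ^ p := by
    have h1 : δ * r ≤ Real.exp (δ * r) := by linarith [Real.add_one_le_exp (δ * r)]
    have h2 : (δ * r) ^ p ≤ Real.exp (2 * (c - h) * r) := by
      calc (δ * r) ^ p ≤ Real.exp (δ * r) ^ p := Real.rpow_le_rpow (by positivity) h1 hp.le
        _ = Real.exp (2 * (c - h) * r) := by
          rw [← Real.exp_mul]
          congr 1
          simp only [δ]
          field_simp
    calc r ^ p * Real.exp (-(2 * (c - h)) * r)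
        = (1 / δ) ^ p * (δ * r) ^ p * Real.exp (-(2 * (c - h)) * r) := by
          rw [← Real.mul_rpow (by positivity) (by positivity)]
          congr 2
          field_simp
      _ ≤ (1 / δ) ^ p * Real.exp (2 * (c - h) * r) * Real.exp (-(2 * (c - h)) * r) := by gcongr
      _ = (1 / δ) ^ p := by
          rw [mul_assoc, ← Real.exp_add]
          simp
  have e1 : r ^ 4 * r ^ (2 * β) = r ^ p := by
    rw [← Real.rpow_natCast r 4, ← Real.rpow_add hr']
    congr 1
    push_cast
    ring
  have e2 : Real.exp (-(r * c)) ^ 2 =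
      Real.exp (-(2 * r * h)) * Real.exp (-(2 * (c - h)) * r) := by
    rw [← Real.exp_nat_mul, ← Real.exp_add]
    congr 1
    push_cast
    ring
  rw [norm_laplace_integrand _ _ hr', Complex.ofReal_re, Real.norm_of_nonneg (by positivity)]
  calc (r ^ 2 * ‖f r‖ * Real.exp (-(r * c))) ^ 2
      = (‖f r‖ ^ 2 * Real.exp (-(2 * r * h))) * (r ^ 4 * Real.exp (-(2 * (c - h)) * r)) := by
        rw [mul_pow, mul_pow, e2]
        ring
    _ ≤ (rayDensity E β h f r * (v * r ^ (2 * β))) *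
          (r ^ 4 * Real.exp (-(2 * (c - h)) * r)) := by gcongr
    _ = rayDensity E β h f r * (v * (r ^ p * Real.exp (-(2 * (c - h)) * r))) := by
        rw [← e1]
        ring
    _ ≤ _ := by gcongr

/-! ### The half-plane integral in terms of the values on the ray -/

/-- Plancherel's theorem on the vertical line at distance `|x|` from the boundary of the
half-plane. -/
theorem lintegral_laplaceMoment_vertical {E : Set ℂ} (hE : IsLeftDomain E) {β h x : ℝ}
    (hβ : -(1 / 2 : ℝ) < β) {f : ℝ → ℂ} (hf : Continuous f)
    (hint : IntegrableOn (rayDensity E β h f) (Ioi 0)) (hx : x < 0) :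
    ∫⁻ y : ℝ, ENNReal.ofReal
        (‖laplaceMoment f 2 ((h : ℂ) - ((x : ℂ) + Complex.I * (y : ℂ)))‖ ^ 2) =
      ENNReal.ofReal (2 * Real.pi) * ∫⁻ r in Ioi (0 : ℝ), ENNReal.ofReal
        (r ^ 4 * (‖f r‖ ^ 2 * Real.exp (-(2 * r * h))) * Real.exp (2 * r * x)) := by
  have hc : h < h - x := by linarith
  have hL := hasLaplaceMoments_of_rayDensity hE hβ hf hint
  have hofReal : ∀ z : ℂ, ENNReal.ofReal (‖z‖ ^ 2) = ‖z‖ₑ ^ 2 := fun z => by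
    rw [ENNReal.ofReal_pow (norm_nonneg _), ofReal_norm]
  have hP := lintegral_enorm_halfLine_fourier_sq
    (hL.integrableOn hf 2 (w := ((h - x : ℝ) : ℂ)) (by simpa using hc))
    (memLp_laplace_integrand hE hβ hf hint hc)
  have hleft : ∀ y : ℝ, laplaceMoment f 2 ((h : ℂ) - ((x : ℂ) + Complex.I * (y : ℂ))) =
      ∫ r in Ioi (0 : ℝ), (r : ℂ) ^ 2 * f r * Complex.exp (-(r * ((h - x : ℝ) : ℂ))) *
        Complex.exp (Complex.I * r * y) := by
    intro y
    refine integral_congr_ae (Filter.Eventually.of_forall fun r => ?_)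
    simp only
    rw [mul_assoc (_ * _) (Complex.exp _), ← Complex.exp_add]
    congr 2
    push_cast
    ring
  simp only [hofReal, hleft]
  rw [hP]
  congr 1
  refine setLIntegral_congr_fun measurableSet_Ioi fun r hr => ?_
  have hr' : 0 < r := hr
  have e : Real.exp (-(r * (h - x))) ^ 2 = Real.exp (-(2 * r * h)) * Real.exp (2 * r * x) := by
    rw [← Real.exp_nat_mul, ← Real.exp_add]
    congr 1
    push_cast
    ring
  rw [← hofReal, norm_laplace_integrand _ _ hr', Complex.ofReal_re, mul_pow, mul_pow, e]
  congr 1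
  ring

theorem lintegral_halfPlane_laplaceMoment {E : Set ℂ} (hE : IsLeftDomain E) {β h : ℝ}
    (hβ : -(1 / 2 : ℝ) < β) {f : ℝ → ℂ} (hf : Continuous f)
    (hint : IntegrableOn (rayDensity E β h f) (Ioi 0)) :
    ∫⁻ y : ℝ, ∫⁻ x in Iio (0 : ℝ), ENNReal.ofReal
        (‖laplaceMoment f 2 ((h : ℂ) - ((x : ℂ) + Complex.I * (y : ℂ)))‖ ^ 2 *
          |x| ^ (2 * β + 3) / stripVol E x) =
      ENNReal.ofReal (2 * Real.pi) * ∫⁻ r in Ioi (0 : ℝ),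
        ENNReal.ofReal (‖f r‖ ^ 2 * Real.exp (-(2 * r * h))) *
          (ENNReal.ofReal (r ^ 4) * stripWeight E β r) := by
  have hs : Measurable (stripVol E) := (stripVol_antitone hE).measurable
  have hm := measurable_laplaceMoment hf 2
  have hfm : Measurable fun r : ℝ => ‖f r‖ := hf.norm.measurable
  have hV : ∀ x, 0 ≤ stripVol E x := fun x => ENNReal.toReal_nonneg
  have hmeas₁ : Measurable fun p : ℝ × ℝ => ENNReal.ofReal
      (‖laplaceMoment f 2 ((h : ℂ) - ((p.2 : ℂ) + Complex.I * (p.1 : ℂ)))‖ ^ 2 *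
          |p.2| ^ (2 * β + 3) / stripVol E p.2) := by fun_prop
  have hmeas₂ : Measurable fun p : ℝ × ℝ =>
      ENNReal.ofReal (|p.1| ^ (2 * β + 3) / stripVol E p.1) * ENNReal.ofReal
        (p.2 ^ 4 * (‖f p.2‖ ^ 2 * Real.exp (-(2 * p.2 * h))) * Real.exp (2 * p.2 * p.1)) := by
    fun_prop
  calc _ = ∫⁻ x in Iio (0 : ℝ), ∫⁻ y : ℝ, ENNReal.ofReal
        (‖laplaceMoment f 2 ((h : ℂ) - ((x : ℂ) + Complex.I * (y : ℂ)))‖ ^ 2 *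
          |x| ^ (2 * β + 3) / stripVol E x) := lintegral_lintegral_swap hmeas₁.aemeasurable
    _ = ∫⁻ x in Iio (0 : ℝ), ENNReal.ofReal (2 * Real.pi) * ∫⁻ r in Ioi (0 : ℝ),
          ENNReal.ofReal (|x| ^ (2 * β + 3) / stripVol E x) * ENNReal.ofReal
        (r ^ 4 * (‖f r‖ ^ 2 * Real.exp (-(2 * r * h))) * Real.exp (2 * r * x)) := by
        refine setLIntegral_congr_fun measurableSet_Iio fun x hx => ?_
        rw [lintegral_const_mul' _ _ ENNReal.ofReal_ne_top, mul_left_comm,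
          ← lintegral_laplaceMoment_vertical hE hβ hf hint hx,
          ← lintegral_const_mul' _ _ ENNReal.ofReal_ne_top]
        refine lintegral_congr fun y => ?_
        have := hV x
        rw [← ENNReal.ofReal_mul (by positivity)]
        congr 1
        ring
    _ = ENNReal.ofReal (2 * Real.pi) * ∫⁻ r in Ioi (0 : ℝ), ∫⁻ x in Iio (0 : ℝ),
          ENNReal.ofReal (|x| ^ (2 * β + 3) / stripVol E x) * ENNReal.ofReal
        (r ^ 4 * (‖f r‖ ^ 2 * Real.exp (-(2 * r * h))) * Real.exp (2 * r * x)) := by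
        rw [lintegral_const_mul' _ _ ENNReal.ofReal_ne_top,
          lintegral_lintegral_swap hmeas₂.aemeasurable]
    _ = _ := by
        congr 1
        refine setLIntegral_congr_fun measurableSet_Ioi fun r hr => ?_
        have hr' : 0 < r := hr
        rw [← mul_assoc (ENNReal.ofReal _) (ENNReal.ofReal _) (stripWeight E β r),
          ← ENNReal.ofReal_mul (by positivity), stripWeight,
          ← lintegral_const_mul' _ _ ENNReal.ofReal_ne_top]
        refine lintegral_congr fun x => ?_
        have := hV x
        rw [← ENNReal.ofReal_mul (by positivity), ← ENNReal.ofReal_mul (by positivity)]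
        congr 1
        ring

theorem halfPlaneIntegral_eq {D : Set ℂ} {φ σ β : ℝ} {F γ : ℂ → ℂ} (hF : HasExpType F σ)
    (hL : HasLaplaceMoments (fun r => F (r * Complex.exp (Complex.I * φ))) (supportFn D φ))
    (hγ : IsBorelTransformOn F σ (halfPlane D φ) γ) :
    halfPlaneIntegral D β φ γ = ∫⁻ y : ℝ, ∫⁻ x in Iio (0 : ℝ), ENNReal.ofReal
        (‖laplaceMoment (fun r => F (r * Complex.exp (Complex.I * φ))) 2
            ((supportFn D φ : ℂ) - ((x : ℂ) + Complex.I * (y : ℂ)))‖ ^ 2 *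
          |x| ^ (2 * β + 3) / stripVol (rotatedDomain D φ) x) := by
  refine lintegral_congr fun y => setLIntegral_congr_fun measurableSet_Iio fun x hx => ?_
  have hx' : x < 0 := hx
  set z := Complex.exp (-(Complex.I * φ)) *
    ((supportFn D φ : ℂ) - ((x : ℂ) + Complex.I * (y : ℂ))) with hz
  have hze : z * Complex.exp (Complex.I * φ) =
      (supportFn D φ : ℂ) - ((x : ℂ) + Complex.I * (y : ℂ)) := by
    rw [hz, Complex.exp_neg, mul_comm, ← mul_assoc, mul_inv_cancel₀ (Complex.exp_ne_zero _),
      one_mul]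
  have hzU : z ∈ halfPlane D φ := by
    change _ < (z * Complex.exp (Complex.I * φ)).re
    rw [hze]
    have hre : ((supportFn D φ : ℂ) - ((x : ℂ) + Complex.I * (y : ℂ))).re = supportFn D φ - x := by
      simp
    rw [hre]
    linarith
  have heq : γ =ᶠ[nhds z] rayBorel F φ :=
    (hγ.eqOn (isBorelTransformOn_rayBorel hF hL)).eventuallyEq_of_mem
      ((isOpen_halfPlane D φ).mem_nhds hzU)
  rw [heq.iteratedDeriv_eq, norm_iteratedDeriv_two_rayBorel hF.entire.continuous hL hzU, hze]
  rfl

theorem theorem1 (β : ℝ) (hβ : -(1 / 2 : ℝ) < β) :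
    ∃ a A : ℝ, 0 < a ∧ 0 < A ∧
      ∀ D : Set ℂ, IsBoundedConvexDomain D →
      ∀ (φ σ : ℝ) (F : ℂ → ℂ), HasExpType F σ → radialIntegral D β φ F < ⊤ →
        (∃ γ : ℂ → ℂ, IsBorelTransformOn F σ (halfPlane D φ) γ) ∧
        ∀ γ : ℂ → ℂ, IsBorelTransformOn F σ (halfPlane D φ) γ →
          ENNReal.ofReal a * radialIntegral D β φ F ≤ halfPlaneIntegral D β φ γ ∧
          halfPlaneIntegral D β φ γ ≤ ENNReal.ofReal A * radialIntegral D β φ F := by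
  have hpi := Real.pi_pos
  have hw := weightConst_pos hβ
  have hm := massConst_pos
  refine ⟨2 * Real.pi * (Real.exp (-2) ^ 2 * (1 / 2) ^ (2 * β + 4)),
    2 * Real.pi * (weightConst β * massConst), by positivity, by positivity, ?_⟩
  intro D hD φ σ F hF hI
  have hE := hD.isLeftDomain_rotatedDomain φ
  set E := rotatedDomain D φ
  set h := supportFn D φ
  set f : ℝ → ℂ := fun r => F (r * Complex.exp (Complex.I * φ))
  have hf : Continuous f := continuous_ray hF.entire.continuous φ
  rw [radialIntegral_eq] at hI ⊢
  have hint := integrableOn_rayDensity hf hI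
  have hL := hasLaplaceMoments_of_rayDensity hE hβ hf hint
  refine ⟨⟨_, isBorelTransformOn_rayBorel hF hL⟩, fun γ hγ => ?_⟩
  rw [halfPlaneIntegral_eq hF hL hγ, lintegral_halfPlane_laplaceMoment hE hβ hf hint]
  have hsplit : ∀ r : ℝ, ENNReal.ofReal (rayDensity E β h f r) =
      ENNReal.ofReal (‖f r‖ ^ 2 * Real.exp (-(2 * r * h))) *
        ENNReal.ofReal (1 / (expMass E r * r ^ (2 * β))) := fun r =>
    ENNReal.ofReal_mul (by positivity)
  have hconst : ∀ c : ℝ, ENNReal.ofReal (2 * Real.pi * c) *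
      ∫⁻ r in Ioi (0 : ℝ), ENNReal.ofReal (rayDensity E β h f r) =
        ENNReal.ofReal (2 * Real.pi) * ∫⁻ r in Ioi (0 : ℝ),
          ENNReal.ofReal (‖f r‖ ^ 2 * Real.exp (-(2 * r * h))) *
            (ENNReal.ofReal c * ENNReal.ofReal (1 / (expMass E r * r ^ (2 * β)))) := by
    intro c
    rw [ENNReal.ofReal_mul (by positivity), mul_assoc,
      ← lintegral_const_mul' _ _ ENNReal.ofReal_ne_top]
    congr 2 with r
    rw [hsplit, mul_left_comm]
  rw [hconst, hconst]
  constructor <;> refine mul_le_mul_right (setLIntegral_mono' measurableSet_Ioi fun r hr => ?_) _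
  · exact mul_le_mul_right (weight_comparison hE hβ hr).1 _
  · exact mul_le_mul_right (weight_comparison hE hβ hr).2 _
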